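/- Let $q\ge 2$ be an integer and $\mathcal Q=\mathbb Z/q$. Write $x\in\mathcal Q^{2,n}$ as $n$ blocks of length $2$. Let $e_i$ ($i=1,2$) be the number of blocks whose rightmost nonzero entry is in position $i$; the ordered weight of $x$ is $e_1+2e_2$, and the ordered distance of $x,y$ is the ordered weight of $x-y$. A $(2n,M,d)$ code is a nonempty set of $M$ vectors in $\mathcal Q^{2,n}$ with pairwise ordered distances at least $d$. A set of the $2n$ coordinates is left-adjusted if with the second coordinate of a block it contains the first coordinate of that block. An ordered orthogonal array (OOA) of strength $t\le 2n$ is a nonempty set of $M$ vectors in $\mathcal Q^{2,n}$ whose projection on any left-adjusted set of $t$ coordinates contains each of the $q^t$ possible rows the same number $\theta$ of times. A sequence of codes (OOAs) of sizes $M_i$ in $\mathcal Q^{2,n_i}$, $n_i\to\infty$, has asymptotic rate $R$ if $\frac{1}{2n_i}\log_q M_i\to R$. It has relative distance $\delta$ (relative strength $\delta$) if $d_i/(2n_i)\to\delta$ (respectively $t_i/(2n_i)\to\delta$). For $y\in[0,1]$ let $$\gamma(y)=\frac{q-1}{q}-\frac{q-2}{q}\,y-\frac 2q\sqrt{(q-1)y(1-y)},\qquad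 h_q(y)=-y\log_q\frac{y}{q-1}-(1-y)\log_q(1-y)$$ (with $0\log_q 0=0$), and let $$\Phi(\delta)=\min_{\tau_1,\tau_2}\ \tfrac12\Big\{\tau_2+h_q(\tau_1)+(1-\tau_1)\,h_q\Big(\frac{\tau_2}{1-\tau_1}\Big)\Big\},$$ where the minimum is over all real $\tau_1,\tau_2$ with $$0\le\tau_1\le\frac{q-1}{q^2},\qquad 0\le\tau_2\le\frac{q-1}{q},\qquad \gamma(\tau_2)+(2-\gamma(\tau_2))(1-\tau_2)\gamma(\tau_1)\le 2\delta .$$ **Theorem.** Let $\delta$ be a real number for which some pair $(\tau_1,\tau_2)$ satisfies these constraints. Then the minimum $\Phi(\delta)$ is attained; every sequence of codes of relative distance $\delta$ and asymptotic rate $R$ satisfies $R\le\Phi(\delta)$; and every sequence of OOAs of relative strength $\delta$ and asymptotic rate $R$ satisfies $R\ge 1-\Phi(\delta)$. -/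

import Mathlib

open Filter Topology

noncomputable section

/-- The set `Q^{r,n}` of vectors made of `n` blocks of length `r`, over the alphabet `Q = ZMod q`
viewed as an additive group mod `q`: `x k j` is the entry in position `j + 1` of block `k`. -/
abbrev NRTSpace (q r n : ℕ) : Type := Fin n → Fin r → ZMod q

/-- The position, counted from `1`, of the rightmost nonzero entry of a block
(and `0` for the zero block). -/
def lastNonzero {q r : ℕ} (b : Fin r → ZMod q) : ℕ :=
  Finset.univ.sup fun j : Fin r => if b j ≠ 0 then (j : ℕ) + 1 else 0

/-- The shape `(e_1, …, e_r)` of a vector: `shape x i` is the number of blocks whose rightmost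
nonzero entry is in position `i + 1`. -/
def shape {q r n : ℕ} (x : NRTSpace q r n) (i : Fin r) : ℕ :=
  (Finset.univ.filter fun k : Fin n => lastNonzero (x k) = (i : ℕ) + 1).card

/-- The ordered weight `w(x) = |e|' = ∑ i e_i`, where `e` is the shape of `x`. -/
def orderedWeight {q r n : ℕ} (x : NRTSpace q r n) : ℕ :=
  ∑ i : Fin r, ((i : ℕ) + 1) * shape x i

/-- The ordered (Niederreiter-Rosenbloom-Tsfasman) distance. -/
def orderedDist {q r n : ℕ} (x y : NRTSpace q r n) : ℕ :=
  orderedWeight (x - y)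

/-- `C` is an `(nr, M, d)` ordered code: a set of `M` vectors such that any two distinct ones are
at ordered distance `d` or more. -/
structure IsOrderedCode {q r n : ℕ} (C : Finset (NRTSpace q r n)) (M d : ℕ) : Prop where
  card_eq : C.card = M
  nonempty : C.Nonempty
  le_dist : ∀ x ∈ C, ∀ y ∈ C, x ≠ y → d ≤ orderedDist x y

/-- A set of coordinates is left-adjusted if with any coordinate it contains all the preceding
coordinates of the same block. -/
def IsLeftAdjusted {r n : ℕ} (I : Finset (Fin n × Fin r)) : Prop :=
  ∀ (k : Fin n) (j j' : Fin r), (k, j) ∈ I → j' ≤ j → (k, j') ∈ I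

/-- `A` is a `(t, n, r, q)` ordered orthogonal array of size `M` and index `θ`: its projection on
any left-adjusted set of `t` coordinates contains each of the `q ^ t` rows exactly `θ` times. -/
structure IsOOA {q r n : ℕ} (A : Finset (NRTSpace q r n)) (M t θ : ℕ) : Prop where
  card_eq : A.card = M
  nonempty : A.Nonempty
  strength_le : t ≤ r * n
  count_eq : ∀ I : Finset (Fin n × Fin r), IsLeftAdjusted I → I.card = t →
    ∀ p : I → ZMod q, (A.filter fun x => ∀ c : I, x c.1.1 c.1.2 = p c).card = θ

/-- The `q`-ary entropy function
`h_q(x) = - x log_q (x / (q - 1)) - (1 - x) log_q (1 - x)`, with `0 log 0 = 0`. -/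
def entropyq (q : ℕ) (x : ℝ) : ℝ :=
  -x * Real.logb q (x / (q - 1)) - (1 - x) * Real.logb q (1 - x)

/-- The function `γ(y)`, the limit of `x_1(n, s) / n` as `n → ∞`, `s / n → y`, where `x_1(n, s)` is
the smallest root of the Krawtchouk polynomial of degree `s`. -/
def krawtchoukGamma (q : ℕ) (y : ℝ) : ℝ :=
  (q - 1) / q - (q - 2) / q * y - 2 / q * Real.sqrt ((q - 1) * y * (1 - y))

/-- The set of pairs `(τ_1, τ_2)` over which the minimum defining `Φ(δ)` is taken. -/
def feasiblePairs (q : ℕ) (δ : ℝ) : Set (ℝ × ℝ) :=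
  {τ | 0 ≤ τ.1 ∧ τ.1 ≤ ((q : ℝ) - 1) / (q : ℝ) ^ 2 ∧
       0 ≤ τ.2 ∧ τ.2 ≤ ((q : ℝ) - 1) / q ∧
       krawtchoukGamma q τ.2 +
         (2 - krawtchoukGamma q τ.2) * (1 - τ.2) * krawtchoukGamma q τ.1 ≤ 2 * δ}

/-- The function of `(τ_1, τ_2)` that is minimized in the definition of `Φ(δ)`. -/
def rateExponent (q : ℕ) (τ : ℝ × ℝ) : ℝ :=
  1 / 2 * (τ.2 + entropyq q τ.1 + (1 - τ.1) * entropyq q (τ.2 / (1 - τ.1)))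

/-- `Φ(δ)`, the minimum of `rateExponent` over `feasiblePairs`. -/
def codeBoundPhi (q : ℕ) (δ : ℝ) : ℝ :=
  sInf (rateExponent q '' feasiblePairs q δ)

/-- The codes or arrays of sizes `M i` in `Q^{r, n i}` have asymptotic rate `R`:
`log_q (M i) / (r n_i) → R`. -/
def HasAsymptoticRate (q r : ℕ) (n M : ℕ → ℕ) (R : ℝ) : Prop :=
  Tendsto (fun i => Real.logb q (M i) / ((r : ℝ) * n i)) atTop (𝓝 R)

/-- The distances (or strengths) `d i` in `Q^{r, n i}` have asymptotic relative value `δ`: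
`d_i / (r n_i) → δ`. -/
def HasRelativeLimit (r : ℕ) (n d : ℕ → ℕ) (δ : ℝ) : Prop :=
  Tendsto (fun i => (d i : ℝ) / ((r : ℝ) * n i)) atTop (𝓝 δ)

end

/-! This is a linear programming bound obtained spectrally. On `Q^{2,n}` take the convolution
operator `stepOp`, which changes one block at a time. Its step weights are chosen so that every
additive character is an eigenfunction with eigenvalue `2n - w(x)`, where `w` is the ordered weight.

Suppose `u ≥ 0` is nonzero, supported on `S`, and satisfies `stepOp u ≥ μ' u` on `S`. Put `L = 2n -
d`. The function `(2n - w(x) - L)|û(x)|²` is nonpositive where `w(x) ≥ d`, while its Fourier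
transform is nonnegative and at least `(μ' - L)∑u²` at the origin, up to normalization. Since `(∑u)²
≤ |S| ∑u²`, Delsarte's argument bounds a code by `|S|` times `(2n - L)/(μ' - L)`
(`card_code_mul_le`) and bounds an array from below dually (`card_space_mul_le`). For `μ' = nμ` with
`μ > 2 - 2δ` that factor stays bounded, so only the exponent of `|S|` matters.

Two families of pairs `(S, u)` are used. In the first, a product function `∏ ψ(y_k)` is cut down to
its typical set. Its Rayleigh quotient is nearly `n` times `stepSymbol ψ`, the exponent of the
typical set is the entropy of `ψ²`, and maximizing the quotient over nonnegative functions on that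
set produces `u` (`exists_superharmonic_of_symbol`). With `ψ²` uniform on each class of dual weight,
with masses `(1 - τ₁ - τ₂, τ₁, τ₂)`, the entropy is exactly the objective defining `Φ`
(`shapeEntropy_eq_rate`). In the second, `u` is the indicator of the vectors supported on a fixed
fraction of the blocks, which gives a Plotkin line (`hasCertificate_plotkin`).

The constraint on `(τ₁, τ₂)` says `2 - 2δ ≤ c`, where `c = (2 - γ(τ₂))(1 - (1 - τ₂)γ(τ₁))`. The
first family reaches `c` when an explicit sign condition holds (`le_shapeSymbol`); where it fails,
the objective lies above the Plotkin line and the second family suffices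
(`le_shapeSymbol_or_le_rate`). The strict inequality `μ > 2 - 2δ` costs an arbitrarily small
increase of the rate, because `c < 2`. -/

/-- The bilinear form `∑ x k j * y k j` on `Q^{r,n}`. -/
def nrtPairing {q r n : ℕ} (x : NRTSpace q r n) : NRTSpace q r n →+ ZMod q where
  toFun y := ∑ k, ∑ j, x k j * y k j
  map_zero' := by simp
  map_add' y z := by simp [mul_add, Finset.sum_add_distrib]

/-- The additive character of `Q^{r,n}` attached to `x`. -/
noncomputable def nrtChar {q r n : ℕ} [NeZero q] (x : NRTSpace q r n) :
    AddChar (NRTSpace q r n) ℂ :=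
  (ZMod.stdAddChar (N := q)).compAddMonoidHom (nrtPairing x)

/-! ### Orthogonality of characters -/

section Characters

variable {q r n : ℕ} [NeZero q]

theorem nrtChar_apply (x y : NRTSpace q r n) :
    nrtChar x y = ZMod.stdAddChar (∑ k, ∑ j, x k j * y k j) := rfl

theorem nrtChar_comm (x y : NRTSpace q r n) : nrtChar x y = nrtChar y x := by
  simp only [nrtChar_apply, mul_comm]

theorem stdAddChar_eq_one_iff (a : ZMod q) : ZMod.stdAddChar a = (1 : ℂ) ↔ a = 0 := by
  constructor
  · intro h
    apply ZMod.injective_stdAddChar (N := q)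
    rw [h, AddChar.map_zero_eq_one]
  · rintro rfl
    exact AddChar.map_zero_eq_one _

theorem sum_nrtChar (x : NRTSpace q r n) :
    ∑ y, nrtChar x y = if x = 0 then (Fintype.card (NRTSpace q r n) : ℂ) else 0 := by
  split_ifs with h
  · subst h
    simp [nrtChar_apply]
  · apply AddChar.sum_eq_zero_of_ne_one
    intro h1
    apply h
    funext k j
    have h2 := DFunLike.congr_fun h1 (Pi.single k (Pi.single j 1))
    rw [nrtChar_apply, AddChar.one_apply, stdAddChar_eq_one_iff, Finset.sum_eq_single k,
      Finset.sum_eq_single j] at h2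
    · simpa using h2
    · intro b _ hb
      simp [Pi.single_eq_of_ne hb]
    · simp
    · intro b _ hb
      simp [Pi.single_eq_of_ne hb]
    · simp

theorem sum_stdAddChar_mul (c : ZMod q) :
    ∑ b, (ZMod.stdAddChar (c * b) : ℂ) = if c = 0 then (q : ℂ) else 0 := by
  have h := AddChar.sum_mulShift (R := ZMod q) (R' := ℂ) c (ZMod.isPrimitive_stdAddChar q)
  simp only [ZMod.card] at h
  calc ∑ b, (ZMod.stdAddChar (c * b) : ℂ) = ∑ b, ZMod.stdAddChar (b * c) :=
        Finset.sum_congr rfl fun b _ => by rw [mul_comm]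
    _ = _ := by rw [h]; split_ifs <;> simp

theorem nrtChar_neg (x y : NRTSpace q r n) :
    nrtChar x (-y) = (starRingEnd ℂ) (nrtChar x y) := by
  rw [AddChar.map_neg_eq_conj]

theorem nrtChar_sub (x y z : NRTSpace q r n) :
    nrtChar x (y - z) = nrtChar x y * (starRingEnd ℂ) (nrtChar x z) := by
  rw [sub_eq_add_neg, AddChar.map_add_eq_mul, nrtChar_neg]

end Characters

/-! ### The ordered weight as a sum over blocks -/

section Weight

theorem orderedWeight_eq_sum {q r n : ℕ} (x : NRTSpace q r n) :
    orderedWeight x = ∑ k, lastNonzero (x k) := by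
  have key : ∀ b : Fin r → ZMod q,
      lastNonzero b = ∑ i : Fin r, if lastNonzero b = (i : ℕ) + 1 then (i : ℕ) + 1 else 0 := by
    intro b
    have hle : lastNonzero b ≤ r := by
      refine Finset.sup_le fun j _ => ?_
      split_ifs
      · exact j.2
      · omega
    rcases Nat.eq_zero_or_pos (lastNonzero b) with h | h
    · simp [h]
    · rw [Finset.sum_eq_single (⟨lastNonzero b - 1, by omega⟩ : Fin r)]
      · rw [if_pos] <;> simp only <;> omega
      · intro i _ hi
        rw [if_neg]
        intro h2
        apply hi
        ext
        simp [h2]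
      · simp
  simp only [orderedWeight, shape]
  calc ∑ i : Fin r, ((i : ℕ) + 1) * (Finset.univ.filter fun k : Fin n =>
          lastNonzero (x k) = (i : ℕ) + 1).card
      = ∑ i : Fin r, ∑ k : Fin n, if lastNonzero (x k) = (i : ℕ) + 1 then (i : ℕ) + 1 else 0 := by
        refine Finset.sum_congr rfl fun i _ => ?_
        rw [← Finset.sum_filter, Finset.sum_const, smul_eq_mul, mul_comm]
    _ = ∑ k, lastNonzero (x k) := by
        rw [Finset.sum_comm]
        exact Finset.sum_congr rfl fun k _ => (key (x k)).symm

/-- This splits the eigenvalue into indicators of two subgroups of the block. Each is the transform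
of a uniform measure on the annihilator, which is how `stepWeight` arises. -/
theorem two_sub_lastNonzero {q : ℕ} (b : Fin 2 → ZMod q) :
    (2 : ℂ) - lastNonzero b = (if b = 0 then 1 else 0) + if b 1 = 0 then 1 else 0 := by
  have hb : b = 0 ↔ b 0 = 0 ∧ b 1 = 0 := by
    rw [funext_iff]; simp [Fin.forall_fin_two]
  have h : lastNonzero b = max (if b 0 ≠ 0 then 1 else 0) (if b 1 ≠ 0 then 2 else 0) := by
    have : (Finset.univ : Finset (Fin 2)) = {0, 1} := rfl
    simp [lastNonzero, this]
  rw [h]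
  simp only [hb]
  by_cases h0 : b 0 = 0 <;> by_cases h1 : b 1 = 0 <;> simp [h0, h1] <;> norm_num

theorem lastNonzero_zero {q r : ℕ} : lastNonzero (0 : Fin r → ZMod q) = 0 := by
  simp [lastNonzero]

theorem orderedWeight_zero {q r n : ℕ} : orderedWeight (0 : NRTSpace q r n) = 0 := by
  simp [orderedWeight_eq_sum, lastNonzero_zero]

end Weight

/-- The weights of the steps, inside a block, of a walk on `Q^{2,n}` whose eigenvalues are
determined by the ordered weight. -/
noncomputable def stepWeight {q : ℕ} (b : Fin 2 → ZMod q) : ℝ :=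
  1 / (q : ℝ) ^ 2 + if b 0 = 0 then 1 / (q : ℝ) else 0

/-- The operator of the walk on `Q^{2,n}` that changes one block according to `stepWeight`. -/
noncomputable def stepOp {q n : ℕ} [NeZero q] (u : NRTSpace q 2 n → ℝ) (y : NRTSpace q 2 n) : ℝ :=
  ∑ k, ∑ b : Fin 2 → ZMod q, stepWeight b * u (y + Pi.single k b)

/-! ### The walk and its spectrum -/

section Operator

theorem stepWeight_nonneg {q : ℕ} (b : Fin 2 → ZMod q) : 0 ≤ stepWeight b := by
  unfold stepWeight
  split_ifs <;> positivity

theorem lastNonzero_neg {q r : ℕ} (b : Fin r → ZMod q) : lastNonzero (-b) = lastNonzero b := by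
  simp [lastNonzero]

variable {q n : ℕ} [NeZero q]

theorem sum_fin_two_fun {M : Type*} [AddCommMonoid M] (f : (Fin 2 → ZMod q) → M) :
    ∑ b, f b = ∑ b₀, ∑ b₁, f ![b₀, b₁] := by
  rw [← Fintype.sum_prod_type']
  exact Fintype.sum_equiv (finTwoArrowEquiv _) _ _ fun b => by
    congr 1
    funext i
    fin_cases i <;> rfl

/-- The uniform measure on all blocks transforms to the indicator of `c = 0`, and the uniform
measure on the blocks with first entry `0` to the indicator of `c 1 = 0`. The walk thus sees
positions in the opposite order: a block has dual weight `2` if its first entry is nonzero, `1` if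
only its second is. -/
theorem sum_stepWeight_char (c : Fin 2 → ZMod q) :
    ∑ b : Fin 2 → ZMod q, (stepWeight b : ℂ) * ZMod.stdAddChar (∑ j, c j * b j) =
      2 - lastNonzero c := by
  have hq : (q : ℂ) ≠ 0 := Nat.cast_ne_zero.2 (NeZero.ne q)
  have hb : c = 0 ↔ c 0 = 0 ∧ c 1 = 0 := by
    rw [funext_iff]; simp [Fin.forall_fin_two]
  rw [two_sub_lastNonzero, sum_fin_two_fun]
  have h : ∀ b₀ b₁ : ZMod q,
      (stepWeight ![b₀, b₁] : ℂ) * ZMod.stdAddChar (∑ j, c j * ![b₀, b₁] j) =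
      (1 / (q : ℂ) ^ 2 + if b₀ = 0 then 1 / (q : ℂ) else 0) * ZMod.stdAddChar (c 0 * b₀) *
        ZMod.stdAddChar (c 1 * b₁) := by
    intro b₀ b₁
    rw [Fin.sum_univ_two, AddChar.map_add_eq_mul, ← mul_assoc]
    simp only [stepWeight, Matrix.cons_val_zero, Matrix.cons_val_one]
    congr 2
    by_cases h0 : b₀ = 0 <;> simp [h0]
  simp only [h, ← Finset.mul_sum, sum_stdAddChar_mul]
  rw [← Finset.sum_mul]
  simp only [add_mul, Finset.sum_add_distrib, ← Finset.mul_sum, sum_stdAddChar_mul, ite_mul,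
    zero_mul, Finset.sum_ite_eq', Finset.mem_univ, if_true, hb]
  by_cases h0 : c 0 = 0 <;> by_cases h1 : c 1 = 0 <;> simp [h0, h1] <;> field_simp

theorem nrtChar_single (x : NRTSpace q 2 n) (k : Fin n) (b : Fin 2 → ZMod q) :
    nrtChar x (Pi.single k b) = ZMod.stdAddChar (∑ j, x k j * b j) := by
  rw [nrtChar_apply, Finset.sum_eq_single k]
  · simp
  · intro l _ hl
    simp [Pi.single_eq_of_ne hl]
  · simp

/-- The characters diagonalise `stepOp`, with eigenvalues `2 n - w(x)`. -/
theorem sum_stepOp_char (u : NRTSpace q 2 n → ℝ) (x : NRTSpace q 2 n) :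
    ∑ y, (stepOp u y : ℂ) * nrtChar x y =
      ((2 * n - orderedWeight x : ℝ) : ℂ) * ∑ y, (u y : ℂ) * nrtChar x y := by
  have h1 : ∀ (k : Fin n) (b : Fin 2 → ZMod q),
      ∑ y, (u (y + Pi.single k b) : ℂ) * nrtChar x y =
      (∑ y, (u y : ℂ) * nrtChar x y) * ZMod.stdAddChar (∑ j, (-x k) j * b j) := by
    intro k b
    rw [← Equiv.sum_comp (Equiv.subRight (Pi.single k b)), Finset.sum_mul]
    refine Finset.sum_congr rfl fun y _ => ?_
    have : nrtChar x (Equiv.subRight (Pi.single k b) y) =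
        nrtChar x y * ZMod.stdAddChar (∑ j, (-x k) j * b j) := by
      rw [Equiv.subRight_apply, sub_eq_add_neg, AddChar.map_add_eq_mul,
        AddChar.map_neg_eq_inv, nrtChar_single, ← AddChar.map_neg_eq_inv]
      simp
    rw [this]
    simp [mul_assoc]
  calc ∑ y, (stepOp u y : ℂ) * nrtChar x y
      = ∑ k : Fin n, ∑ b : Fin 2 → ZMod q, (stepWeight b : ℂ) *
          ∑ y, (u (y + Pi.single k b) : ℂ) * nrtChar x y := by
        simp only [stepOp, Complex.ofReal_sum, Finset.sum_mul, Finset.mul_sum]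
        rw [Finset.sum_comm]
        refine Finset.sum_congr rfl fun k _ => ?_
        rw [Finset.sum_comm]
        refine Finset.sum_congr rfl fun b _ => Finset.sum_congr rfl fun y _ => ?_
        push_cast
        ring
    _ = ∑ k : Fin n, (2 - (lastNonzero (x k) : ℂ)) * ∑ y, (u y : ℂ) * nrtChar x y := by
        refine Finset.sum_congr rfl fun k _ => ?_
        rw [← lastNonzero_neg (x k), ← sum_stepWeight_char, Finset.sum_mul]
        refine Finset.sum_congr rfl fun b _ => ?_
        rw [h1]
        ring
    _ = _ := by
        rw [← Finset.sum_mul, orderedWeight_eq_sum]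
        simp [mul_comm]

end Operator

/-! ### Linear programming bounds from superharmonic functions -/

section LinearProgramming

variable {q n : ℕ} [NeZero q]

theorem eigenvalue_mul_normSq (u : NRTSpace q 2 n → ℝ) (L : ℝ) (x : NRTSpace q 2 n) :
    (((2 * n - orderedWeight x - L) * Complex.normSq (∑ y, (u y : ℂ) * nrtChar x y) : ℝ) : ℂ) =
      ∑ y, ∑ y', (((stepOp u y - L * u y) * u y' : ℝ) : ℂ) * nrtChar x (y - y') := by
  have h1 : ∑ y, ((stepOp u y - L * u y : ℝ) : ℂ) * nrtChar x y =
      ((2 * n - orderedWeight x - L : ℝ) : ℂ) * ∑ y, (u y : ℂ) * nrtChar x y := by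
    have : ∀ y, ((stepOp u y - L * u y : ℝ) : ℂ) * nrtChar x y =
        (stepOp u y : ℂ) * nrtChar x y - (L : ℂ) * ((u y : ℂ) * nrtChar x y) := by
      intro y; push_cast; ring
    simp only [this, Finset.sum_sub_distrib, sum_stepOp_char, ← Finset.mul_sum]
    push_cast
    ring
  rw [Complex.ofReal_mul, Complex.normSq_eq_conj_mul_self, mul_left_comm, ← h1, map_sum,
    mul_comm, Finset.sum_mul]
  refine Finset.sum_congr rfl fun y _ => ?_
  rw [Finset.mul_sum]
  refine Finset.sum_congr rfl fun y' _ => ?_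
  rw [nrtChar_sub, map_mul, Complex.conj_ofReal]
  push_cast
  ring

theorem normSq_sum_nrtChar (C : Finset (NRTSpace q 2 n)) (z : NRTSpace q 2 n) :
    ((Complex.normSq (∑ c ∈ C, nrtChar z c) : ℝ) : ℂ) = ∑ c ∈ C, ∑ c' ∈ C, nrtChar z (c - c') := by
  rw [Complex.normSq_eq_conj_mul_self, mul_comm, map_sum, Finset.sum_mul]
  simp only [Finset.mul_sum, nrtChar_sub]

theorem sum_sq_le_card_mul {ι : Type*} [Fintype ι] [DecidableEq ι] (u : ι → ℝ) (S : Finset ι)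
    (hS : ∀ y ∉ S, u y = 0) : (∑ y, u y) ^ 2 ≤ S.card * ∑ y, u y ^ 2 := by
  rw [← Finset.sum_subset S.subset_univ fun y _ hy => hS y hy,
    ← Finset.sum_subset S.subset_univ fun y _ hy => show u y ^ 2 = 0 by simp [hS y hy]]
  exact sq_sum_le_card_mul_sum_sq

theorem stepOp_nonneg {u : NRTSpace q 2 n → ℝ} (hu : ∀ y, 0 ≤ u y) (y : NRTSpace q 2 n) :
    0 ≤ stepOp u y :=
  Finset.sum_nonneg fun _ _ => Finset.sum_nonneg fun b _ => mul_nonneg (stepWeight_nonneg b) (hu _)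

/-- Off `S` the function `u` vanishes while `stepOp u` stays nonnegative, so an inequality on `S` is
enough everywhere. -/
theorem le_stepOp_sub_mul {u : NRTSpace q 2 n → ℝ} (hu : ∀ y, 0 ≤ u y)
    {S : Finset (NRTSpace q 2 n)} (hS : ∀ y ∉ S, u y = 0) {μ : ℝ} (L : ℝ)
    (hμ : ∀ y ∈ S, μ * u y ≤ stepOp u y) (y : NRTSpace q 2 n) :
    (μ - L) * u y ≤ stepOp u y - L * u y := by
  by_cases hy : y ∈ S
  · linarith [hμ y hy]
  · simpa [hS y hy] using stepOp_nonneg hu y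

theorem normSq_sum_zero (u : NRTSpace q 2 n → ℝ) :
    Complex.normSq (∑ y, (u y : ℂ) * nrtChar 0 y) = (∑ y, u y) ^ 2 := by
  have : ∑ y, (u y : ℂ) * nrtChar 0 y = ((∑ y, u y : ℝ) : ℂ) := by
    simp [nrtChar_apply]
  rw [this, Complex.normSq_ofReal, sq]

theorem sum_sq_pos_of_ne_zero {ι : Type*} [Fintype ι] {u : ι → ℝ} (hu : u ≠ 0) :
    0 < ∑ y, u y ^ 2 := by
  obtain ⟨y, hy⟩ := Function.ne_iff.1 hu
  exact Finset.sum_pos' (fun _ _ => sq_nonneg _) ⟨y, Finset.mem_univ y, by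
    have : u y ≠ 0 := hy
    positivity⟩

/-- The linear programming bound for codes, with the certificate built from an approximate
eigenfunction of `stepOp` supported on `S`. -/
theorem card_code_mul_le {u : NRTSpace q 2 n → ℝ} (hu : ∀ y, 0 ≤ u y) (hu0 : u ≠ 0)
    {S : Finset (NRTSpace q 2 n)} (hS : ∀ y ∉ S, u y = 0) {μ L : ℝ} (hL : L ≤ μ)
    (hμ : ∀ y ∈ S, μ * u y ≤ stepOp u y) {C : Finset (NRTSpace q 2 n)} (hC0 : C.Nonempty)
    (hC : ∀ x ∈ C, ∀ y ∈ C, x ≠ y → (2 * n - orderedWeight (x - y) : ℝ) ≤ L)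
    (hLn : L ≤ 2 * n) :
    C.card * (μ - L) ≤ (2 * n - L) * S.card := by
  -- The certificate summed over differences of codewords, evaluated on both sides of the Fourier
  -- transform.
  have key : ∑ c ∈ C, ∑ c' ∈ C, (2 * n - orderedWeight (c - c') - L) *
        Complex.normSq (∑ y, (u y : ℂ) * nrtChar (c - c') y) =
      ∑ y, ∑ y', (stepOp u y - L * u y) * u y' *
        Complex.normSq (∑ c ∈ C, nrtChar (y - y') c) := by
    apply Complex.ofReal_injective
    rw [Complex.ofReal_sum]
    simp only [Complex.ofReal_sum]
    have h1 : ∀ y y' : NRTSpace q 2 n,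
        (((stepOp u y - L * u y) * u y' * Complex.normSq (∑ c ∈ C, nrtChar (y - y') c) : ℝ) : ℂ) =
        ∑ c ∈ C, ∑ c' ∈ C,
          (((stepOp u y - L * u y) * u y' : ℝ) : ℂ) * nrtChar (c - c') (y - y') := by
      intro y y'
      rw [Complex.ofReal_mul, normSq_sum_nrtChar, Finset.mul_sum]
      simp only [Finset.mul_sum, nrtChar_comm (y - y')]
    simp only [h1, eigenvalue_mul_normSq]
    have h2 : ∀ c : NRTSpace q 2 n, ∀ f : NRTSpace q 2 n → NRTSpace q 2 n → NRTSpace q 2 n → ℂ,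
        ∑ c' ∈ C, ∑ y, ∑ y', f c' y y' = ∑ y, ∑ y', ∑ c' ∈ C, f c' y y' := by
      intro c f
      rw [Finset.sum_comm]
      exact Finset.sum_congr rfl fun y _ => Finset.sum_comm
    calc _ = ∑ c ∈ C, ∑ y, ∑ y', ∑ c' ∈ C,
          (((stepOp u y - L * u y) * u y' : ℝ) : ℂ) * nrtChar (c - c') (y - y') :=
          Finset.sum_congr rfl fun c _ => h2 c _
      _ = _ := h2 0 _
  set N : ℝ := ∑ y, u y ^ 2 with hN
  have hN0 : 0 < N := sum_sq_pos_of_ne_zero hu0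
  have hcard : (0 : ℝ) < C.card := by exact_mod_cast hC0.card_pos
  have hv := le_stepOp_sub_mul hu hS L hμ
  have hv0 : ∀ y, 0 ≤ stepOp u y - L * u y := fun y =>
    (mul_nonneg (sub_nonneg.2 hL) (hu y)).trans (hv y)
  -- All terms are nonnegative; only those with `y' = y` are kept.
  have lower : (μ - L) * N * (C.card : ℝ) ^ 2 ≤
      ∑ y, ∑ y', (stepOp u y - L * u y) * u y' *
        Complex.normSq (∑ c ∈ C, nrtChar (y - y') c) := by
    rw [hN, Finset.mul_sum, Finset.sum_mul]
    refine Finset.sum_le_sum fun y _ => ?_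
    refine le_trans ?_ (Finset.single_le_sum (fun y' _ => mul_nonneg (mul_nonneg (hv0 y) (hu y'))
      (Complex.normSq_nonneg _)) (Finset.mem_univ y))
    have : Complex.normSq (∑ c ∈ C, nrtChar (y - y) c) = (C.card : ℝ) ^ 2 := by
      simp [nrtChar_apply, Complex.normSq_natCast, sq]
    rw [this]
    apply mul_le_mul_of_nonneg_right _ (sq_nonneg _)
    nlinarith [mul_le_mul_of_nonneg_right (hv y) (hu y)]
  -- By the minimum distance the terms with `c' ≠ c` are nonpositive and are dropped.
  have upper : ∑ c ∈ C, ∑ c' ∈ C, (2 * n - orderedWeight (c - c') - L) *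
        Complex.normSq (∑ y, (u y : ℂ) * nrtChar (c - c') y) ≤
      C.card * ((2 * n - L) * (∑ y, u y) ^ 2) := by
    rw [← nsmul_eq_mul, ← Finset.sum_const]
    refine Finset.sum_le_sum fun c hc => ?_
    rw [Finset.sum_eq_add_sum_sdiff_singleton_of_mem hc]
    have h0 : ∑ c' ∈ C \ {c}, (2 * n - orderedWeight (c - c') - L) *
        Complex.normSq (∑ y, (u y : ℂ) * nrtChar (c - c') y) ≤ 0 := by
      refine Finset.sum_nonpos fun c' hc' => ?_
      rw [Finset.mem_sdiff, Finset.mem_singleton] at hc'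
      exact mul_nonpos_of_nonpos_of_nonneg
        (sub_nonpos.2 (hC c hc c' hc'.1 fun h => hc'.2 h.symm)) (Complex.normSq_nonneg _)
    rw [sub_self, normSq_sum_zero, orderedWeight_zero]
    push_cast
    linarith
  have hsq := sum_sq_le_card_mul u S hS
  have h3 : (μ - L) * N * (C.card : ℝ) ^ 2 ≤ C.card * ((2 * n - L) * (S.card * N)) :=
    (lower.trans (key.symm.le.trans upper)).trans (by gcongr)
  have h4 : (C.card * (μ - L)) * (N * C.card) ≤ ((2 * n - L) * S.card) * (N * C.card) := by
    linarith
  exact le_of_mul_le_mul_right h4 (by positivity)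

/-- The linear programming bound for arrays, with the same certificate. -/
theorem card_space_mul_le {u : NRTSpace q 2 n → ℝ} (hu : ∀ y, 0 ≤ u y) (hu0 : u ≠ 0)
    {S : Finset (NRTSpace q 2 n)} (hS : ∀ y ∉ S, u y = 0) {μ L : ℝ} (hL : L ≤ μ)
    (hμ : ∀ y ∈ S, μ * u y ≤ stepOp u y) {A : Finset (NRTSpace q 2 n)} (hA0 : A.Nonempty)
    (hA : ∀ x, x ≠ 0 → ∑ a ∈ A, nrtChar x a = 0 ∨ (2 * n - orderedWeight x : ℝ) ≤ L)
    (hLn : L ≤ 2 * n) :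
    Fintype.card (NRTSpace q 2 n) * (μ - L) ≤ (2 * n - L) * A.card * S.card := by
  set V : ℝ := (Fintype.card (NRTSpace q 2 n) : ℝ) with hV
  -- Summing over all `x` turns the product of characters into the indicator of `a - a' + (y - y') =
  -- 0`. Below, `lower` keeps `a' = a`, `y' = y`, and `upper` keeps only `x = 0`.
  have key : ∑ x, Complex.normSq (∑ a ∈ A, nrtChar x a) * ((2 * n - orderedWeight x - L) *
        Complex.normSq (∑ y, (u y : ℂ) * nrtChar x y)) =
      ∑ a ∈ A, ∑ a' ∈ A, ∑ y, ∑ y', (stepOp u y - L * u y) * u y' *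
        (if a - a' + (y - y') = 0 then V else 0) := by
    apply Complex.ofReal_injective
    rw [Complex.ofReal_sum]
    simp only [Complex.ofReal_sum]
    have h1 : ∀ a a' y y' : NRTSpace q 2 n,
        (((stepOp u y - L * u y) * u y' * (if a - a' + (y - y') = 0 then V else 0) : ℝ) : ℂ) =
        ∑ x, (((stepOp u y - L * u y) * u y' : ℝ) : ℂ) *
          (nrtChar x (a - a') * nrtChar x (y - y')) := by
      intro a a' y y'
      simp only [← AddChar.map_add_eq_mul]
      simp only [nrtChar_comm _ (a - a' + (y - y')), ← Finset.mul_sum, sum_nrtChar]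
      split_ifs <;> simp [hV]
    have h2 : ∀ x : NRTSpace q 2 n, ((Complex.normSq (∑ a ∈ A, nrtChar x a) *
        ((2 * n - orderedWeight x - L) * Complex.normSq (∑ y, (u y : ℂ) * nrtChar x y)) : ℝ) : ℂ) =
        ∑ a ∈ A, ∑ a' ∈ A, ∑ y, ∑ y', (((stepOp u y - L * u y) * u y' : ℝ) : ℂ) *
          (nrtChar x (a - a') * nrtChar x (y - y')) := by
      intro x
      rw [Complex.ofReal_mul, eigenvalue_mul_normSq, normSq_sum_nrtChar]
      rw [Finset.sum_mul]
      simp only [Finset.sum_mul]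
      simp only [Finset.mul_sum]
      refine Finset.sum_congr rfl fun a _ => Finset.sum_congr rfl fun a' _ =>
        Finset.sum_congr rfl fun y _ => Finset.sum_congr rfl fun y' _ => ?_
      ring
    simp only [h1, h2]
    refine (Finset.sum_comm (s := Finset.univ) (t := A)).trans
      (Finset.sum_congr rfl fun a _ => ?_)
    refine (Finset.sum_comm (s := Finset.univ) (t := A)).trans
      (Finset.sum_congr rfl fun a' _ => ?_)
    refine (Finset.sum_comm (s := Finset.univ) (t := Finset.univ)).trans
      (Finset.sum_congr rfl fun y _ => ?_)
    exact Finset.sum_comm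
  set N : ℝ := ∑ y, u y ^ 2 with hN
  have hN0 : 0 < N := sum_sq_pos_of_ne_zero hu0
  have hcard : (0 : ℝ) < A.card := by exact_mod_cast hA0.card_pos
  have hV0 : 0 ≤ V := by positivity
  have hv := le_stepOp_sub_mul hu hS L hμ
  have hv0 : ∀ y, 0 ≤ stepOp u y - L * u y := fun y =>
    (mul_nonneg (sub_nonneg.2 hL) (hu y)).trans (hv y)
  have lower : A.card * ((μ - L) * N * V) ≤
      ∑ a ∈ A, ∑ a' ∈ A, ∑ y, ∑ y', (stepOp u y - L * u y) * u y' *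
        (if a - a' + (y - y') = 0 then V else 0) := by
    have hnn : ∀ a a' y y' : NRTSpace q 2 n, 0 ≤ (stepOp u y - L * u y) * u y' *
        (if a - a' + (y - y') = 0 then V else 0) := fun a a' y y' =>
      mul_nonneg (mul_nonneg (hv0 y) (hu y')) (by split_ifs <;> simp [hV0])
    rw [← nsmul_eq_mul, ← Finset.sum_const]
    refine Finset.sum_le_sum fun a ha => ?_
    refine le_trans ?_ (Finset.single_le_sum (fun a' _ => Finset.sum_nonneg fun y _ =>
      Finset.sum_nonneg fun y' _ => hnn a a' y y') ha)
    rw [hN, Finset.mul_sum, Finset.sum_mul]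
    refine Finset.sum_le_sum fun y _ => ?_
    refine le_trans ?_ (Finset.single_le_sum (fun y' _ => hnn a a y y') (Finset.mem_univ y))
    rw [if_pos (by simp)]
    apply mul_le_mul_of_nonneg_right _ hV0
    nlinarith [mul_le_mul_of_nonneg_right (hv y) (hu y)]
  have upper : ∑ x, Complex.normSq (∑ a ∈ A, nrtChar x a) * ((2 * n - orderedWeight x - L) *
        Complex.normSq (∑ y, (u y : ℂ) * nrtChar x y)) ≤
      (A.card : ℝ) ^ 2 * ((2 * n - L) * (∑ y, u y) ^ 2) := by
    rw [Finset.sum_eq_add_sum_sdiff_singleton_of_mem (Finset.mem_univ 0)]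
    have h0 : ∑ x ∈ Finset.univ \ {0}, Complex.normSq (∑ a ∈ A, nrtChar x a) *
        ((2 * n - orderedWeight x - L) * Complex.normSq (∑ y, (u y : ℂ) * nrtChar x y)) ≤ 0 := by
      refine Finset.sum_nonpos fun x hx => ?_
      rw [Finset.mem_sdiff, Finset.mem_singleton] at hx
      rcases hA x hx.2 with h | h
      · simp [h]
      · exact mul_nonpos_of_nonneg_of_nonpos (Complex.normSq_nonneg _)
          (mul_nonpos_of_nonpos_of_nonneg (sub_nonpos.2 h) (Complex.normSq_nonneg _))
    have h1 : Complex.normSq (∑ a ∈ A, nrtChar (0 : NRTSpace q 2 n) a) = (A.card : ℝ) ^ 2 := by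
      simp [nrtChar_apply, Complex.normSq_natCast, sq]
    rw [h1, normSq_sum_zero, orderedWeight_zero]
    push_cast
    linarith
  have hsq := sum_sq_le_card_mul u S hS
  have h3 : A.card * ((μ - L) * N * V) ≤ (A.card : ℝ) ^ 2 * ((2 * n - L) * (S.card * N)) :=
    (lower.trans (key.symm.le.trans upper)).trans (by gcongr)
  have h4 : (V * (μ - L)) * (N * A.card) ≤ ((2 * n - L) * A.card * S.card) * (N * A.card) := by
    linarith
  exact le_of_mul_le_mul_right h4 (by positivity)

end LinearProgramming

/-! ### Vanishing of the character sums of an array -/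

section Arrays

variable {q r n : ℕ}

/-- Adding the first missing coordinate of a block keeps a set left-adjusted. -/
theorem IsLeftAdjusted.exists_superset_card {J : Finset (Fin n × Fin r)} (hJ : IsLeftAdjusted J)
    {t : ℕ} (hJt : J.card ≤ t) (ht : t ≤ r * n) :
    ∃ I, J ⊆ I ∧ IsLeftAdjusted I ∧ I.card = t := by
  induction t, hJt using Nat.le_induction with
  | base => exact ⟨J, Finset.Subset.refl J, hJ, rfl⟩
  | succ t _ ih =>
    obtain ⟨I, hJI, hI, hIt⟩ := ih (by omega)
    have hne : ∃ c, c ∉ I := by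
      by_contra! h
      have h1 : I = Finset.univ := Finset.eq_univ_of_forall h
      rw [h1, Finset.card_univ, Fintype.card_prod, Fintype.card_fin, Fintype.card_fin,
        mul_comm] at hIt
      omega
    obtain ⟨⟨k, j⟩, hkj⟩ := hne
    obtain ⟨j', hj', hmin⟩ := (Finset.univ.filter fun j => (k, j) ∉ I).exists_minimal
      ⟨j, by simpa using hkj⟩
    rw [Finset.mem_filter] at hj'
    refine ⟨insert (k, j') I, hJI.trans (Finset.subset_insert _ _), ?_, by
      rw [Finset.card_insert_of_notMem hj'.2, hIt]⟩
    intro l i i' hi hii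
    rw [Finset.mem_insert] at hi ⊢
    rcases hi with hi | hi
    · obtain ⟨rfl, rfl⟩ := Prod.mk.inj hi
      by_cases h : (l, i') ∈ I
      · exact Or.inr h
      · left
        rw [le_antisymm hii (hmin (by simpa using h) hii)]
    · exact Or.inr (hI l i i' hi hii)

theorem addChar_sum {ι G : Type*} [AddCommGroup G] (ψ : AddChar G ℂ) (s : Finset ι) (f : ι → G) :
    ψ (∑ i ∈ s, f i) = ∏ i ∈ s, ψ (f i) := by
  classical
  induction s using Finset.induction_on with
  | empty => simp
  | insert i s hi ih => rw [Finset.sum_insert hi, Finset.prod_insert hi, AddChar.map_add_eq_mul, ih]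

theorem sum_stdAddChar_sum_mul [NeZero q] {ι : Type*} [Fintype ι] [DecidableEq ι] {x : ι → ZMod q}
    {i : ι} (hx : x i ≠ 0) : ∑ p : ι → ZMod q, (ZMod.stdAddChar (∑ i, x i * p i) : ℂ) = 0 := by
  have h := Finset.prod_univ_sum (fun _ : ι => (Finset.univ : Finset (ZMod q)))
    (fun i b => (ZMod.stdAddChar (x i * b) : ℂ))
  rw [Fintype.piFinset_univ] at h
  simp only [addChar_sum, ← h]
  exact Finset.prod_eq_zero (Finset.mem_univ i) (by rw [sum_stdAddChar_mul, if_neg hx])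

theorem lastNonzero_le (b : Fin r → ZMod q) : lastNonzero b ≤ r := by
  refine Finset.sup_le fun j _ => ?_
  split_ifs
  · exact j.2
  · omega

theorem le_lastNonzero {b : Fin r → ZMod q} {j : Fin r} (hj : b j ≠ 0) :
    (j : ℕ) + 1 ≤ lastNonzero b := by
  have := Finset.le_sup (f := fun j : Fin r => if b j ≠ 0 then (j : ℕ) + 1 else 0)
    (Finset.mem_univ j)
  simpa [hj, lastNonzero] using this

/-- The left-adjusted hull of the support of a vector has as many elements as its ordered
weight. -/
theorem exists_hull (x : NRTSpace q r n) : ∃ J : Finset (Fin n × Fin r),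
    IsLeftAdjusted J ∧ J.card = orderedWeight x ∧ ∀ k j, x k j ≠ 0 → (k, j) ∈ J := by
  refine ⟨Finset.univ.filter fun c => (c.2 : ℕ) + 1 ≤ lastNonzero (x c.1), ?_, ?_, ?_⟩
  · intro k j j' hj hjj
    rw [Finset.mem_filter] at hj ⊢
    have : (j' : ℕ) ≤ j := hjj
    exact ⟨Finset.mem_univ _, by have := hj.2; simp only at this ⊢; omega⟩
  · rw [orderedWeight_eq_sum, Finset.card_filter, Fintype.sum_prod_type]
    refine Finset.sum_congr rfl fun k _ => ?_
    rw [Fin.sum_univ_eq_sum_range (fun j => if j + 1 ≤ lastNonzero (x k) then 1 else 0) r,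
      ← Finset.card_filter]
    have h : (Finset.range r).filter (fun j => j + 1 ≤ lastNonzero (x k)) =
        Finset.range (lastNonzero (x k)) := by
      ext j
      have := lastNonzero_le (x k)
      simp only [Finset.mem_filter, Finset.mem_range]
      omega
    rw [h, Finset.card_range]
  · intro k j hj
    rw [Finset.mem_filter]
    exact ⟨Finset.mem_univ _, le_lastNonzero hj⟩

/-- The support of `x` fits in a left-adjusted set `I` of exactly `t` coordinates. The character
then depends only on the projection to `I`, which is uniform, and a nontrivial character has sum
zero. -/
theorem IsOOA.sum_nrtChar_eq_zero [NeZero q] {A : Finset (NRTSpace q r n)} {M t θ : ℕ}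
    (hA : IsOOA A M t θ) {x : NRTSpace q r n} (hx : x ≠ 0) (hxt : orderedWeight x ≤ t) :
    ∑ a ∈ A, nrtChar x a = 0 := by
  obtain ⟨J, hJ, hJc, hJx⟩ := exists_hull x
  obtain ⟨I, hJI, hI, hIt⟩ := hJ.exists_superset_card (hJc.trans_le hxt) hA.strength_le
  have h1 : ∀ a : NRTSpace q r n,
      nrtChar x a = ZMod.stdAddChar (∑ c : I, x c.1.1 c.1.2 * a c.1.1 c.1.2) := by
    intro a
    rw [nrtChar_apply, ← Fintype.sum_prod_type' (f := fun k j => x k j * a k j),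
      Finset.sum_coe_sort I (fun c => x c.1 c.2 * a c.1 c.2)]
    congr 1
    refine (Finset.sum_subset I.subset_univ fun c _ hc => ?_).symm
    rw [show x c.1 c.2 = 0 by
      by_contra h
      exact hc (hJI (hJx _ _ h)), zero_mul]
  obtain ⟨k, hk⟩ := Function.ne_iff.1 hx
  obtain ⟨j, hj⟩ := Function.ne_iff.1 hk
  have hkj : (k, j) ∈ I := hJI (hJx k j hj)
  calc ∑ a ∈ A, nrtChar x a
      = ∑ p : I → ZMod q, ∑ a ∈ A.filter fun a => (fun c : I => a c.1.1 c.1.2) = p,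
          nrtChar x a := (Finset.sum_fiberwise A (fun a => fun c : I => a c.1.1 c.1.2) _).symm
    _ = ∑ p : I → ZMod q, (θ : ℂ) * ZMod.stdAddChar (∑ c : I, x c.1.1 c.1.2 * p c) := by
        refine Finset.sum_congr rfl fun p _ => ?_
        rw [← hA.count_eq I hI hIt p, ← nsmul_eq_mul, ← Finset.sum_const]
        have hf : (A.filter fun a => (fun c : I => a c.1.1 c.1.2) = p) =
            A.filter fun a => ∀ c : I, a c.1.1 c.1.2 = p c :=
          Finset.filter_congr fun a _ => funext_iff
        rw [hf]
        refine Finset.sum_congr rfl fun a ha => ?_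
        rw [h1]
        congr 1
        exact Finset.sum_congr rfl fun c _ => by rw [(Finset.mem_filter.1 ha).2 c]
    _ = 0 := by
        rw [← Finset.mul_sum,
          sum_stdAddChar_sum_mul (x := fun c : I => x c.1.1 c.1.2) (i := ⟨(k, j), hkj⟩) hj,
          mul_zero]

end Arrays

/-! ### From Rayleigh quotients to superharmonic functions -/

section Superharmonic

variable {ι : Type*} [Fintype ι] [DecidableEq ι]

/-- A symmetric positive operator with Rayleigh quotient at least `μ` on some nonnegative function supported
on `S` has a nonnegative function on `S` that is `μ`-superharmonic on `S`. -/
theorem exists_mul_le_apply (T : (ι → ℝ) →ₗ[ℝ] (ι → ℝ))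
    (hT : ∀ u v, ∑ y, u y * T v y = ∑ y, v y * T u y)
    (hTpos : ∀ u, (∀ y, 0 ≤ u y) → ∀ y, 0 ≤ T u y) {S : Finset ι} {f : ι → ℝ}
    (hf : ∀ y, 0 ≤ f y) (hfS : ∀ y ∉ S, f y = 0) (hf0 : f ≠ 0) {μ : ℝ}
    (hμ : μ * ∑ y, f y ^ 2 ≤ ∑ y, f y * T f y) :
    ∃ u : ι → ℝ, (∀ y, 0 ≤ u y) ∧ u ≠ 0 ∧ (∀ y ∉ S, u y = 0) ∧ ∀ y ∈ S, μ * u y ≤ T u y := by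
  -- The function sought is a maximizer of the quadratic form on this compact set; the claim is its
  -- first-order condition at each point of `S`.
  set K : Set (ι → ℝ) := {u | (∀ y, 0 ≤ u y) ∧ (∀ y ∉ S, u y = 0) ∧ ∑ y, u y ^ 2 = 1} with hK
  have hcont : Continuous fun u : ι → ℝ => ∑ y, u y * T u y := by
    have := LinearMap.continuous_of_finiteDimensional T
    fun_prop
  have hKc : IsCompact K := by
    refine (isCompact_univ_pi fun _ : ι => isCompact_Icc (a := (0 : ℝ)) (b := 1)).of_isClosed_subset
      ?_ ?_
    · rw [hK]
      simp only [Set.ofPred_and, Set.ofPred_forall]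
      refine (isClosed_iInter fun y => isClosed_le continuous_const (continuous_apply y)).inter
        ((isClosed_iInter fun y => isClosed_iInter fun _ =>
          isClosed_eq (continuous_apply y) continuous_const).inter
          (isClosed_eq (by fun_prop) continuous_const))
    · rintro u ⟨h1, -, h3⟩ y -
      refine ⟨h1 y, ?_⟩
      have : u y ^ 2 ≤ 1 := h3 ▸ Finset.single_le_sum (f := fun y => u y ^ 2)
        (fun _ _ => sq_nonneg _) (Finset.mem_univ y)
      nlinarith [h1 y]
  have hscale : ∀ g : ι → ℝ, (∀ y, 0 ≤ g y) → (∀ y ∉ S, g y = 0) → g ≠ 0 →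
      ∃ g' ∈ K, ∑ y, g y * T g y = (∑ y, g y ^ 2) * ∑ y, g' y * T g' y := by
    intro g hg hgS hg0
    have hpos := sum_sq_pos_of_ne_zero hg0
    set N := ∑ y, g y ^ 2
    have hsq : Real.sqrt N ^ 2 = N := Real.sq_sqrt hpos.le
    have hs : 0 < Real.sqrt N := Real.sqrt_pos.2 hpos
    refine ⟨(Real.sqrt N)⁻¹ • g, ⟨fun y => ?_, fun y hy => ?_, ?_⟩, ?_⟩
    · exact mul_nonneg (inv_nonneg.2 hs.le) (hg y)
    · simp [hgS y hy]
    · simp only [Pi.smul_apply, smul_eq_mul, mul_pow, ← Finset.mul_sum]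
      rw [inv_pow, hsq, inv_mul_cancel₀ hpos.ne']
    · rw [map_smul]
      simp only [Pi.smul_apply, smul_eq_mul]
      have : ∀ y, (Real.sqrt N)⁻¹ * g y * ((Real.sqrt N)⁻¹ * T g y) = N⁻¹ * (g y * T g y) := by
        intro y
        have : (Real.sqrt N)⁻¹ * (Real.sqrt N)⁻¹ = N⁻¹ := by rw [← mul_inv, ← sq, hsq]
        rw [← this]
        ring
      simp only [this, ← Finset.mul_sum]
      rw [mul_inv_cancel_left₀ hpos.ne']
  obtain ⟨f', hf'K, hf'⟩ := hscale f hf hfS hf0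
  obtain ⟨u, huK, humax⟩ := hKc.exists_isMaxOn ⟨f', hf'K⟩ hcont.continuousOn
  set ν := ∑ y, u y * T u y with hν
  have hall : ∀ g : ι → ℝ, (∀ y, 0 ≤ g y) → (∀ y ∉ S, g y = 0) →
      ∑ y, g y * T g y ≤ ν * ∑ y, g y ^ 2 := by
    intro g hg hgS
    by_cases hg0 : g = 0
    · simp [hg0]
    · obtain ⟨g', hg'K, hg'⟩ := hscale g hg hgS hg0
      rw [hg', mul_comm]
      exact mul_le_mul_of_nonneg_right (humax hg'K) (Finset.sum_nonneg fun _ _ => sq_nonneg _)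
  have hμν : μ ≤ ν :=
    le_of_mul_le_mul_right (hμ.trans (hall f hf hfS)) (sum_sq_pos_of_ne_zero hf0)
  obtain ⟨hu, huS, hu1⟩ := huK
  refine ⟨u, hu, ?_, huS, fun y hy => ?_⟩
  · rintro rfl
    simp at hu1
  refine (mul_le_mul_of_nonneg_right hμν (hu y)).trans ?_
  by_contra! hlt
  -- Positivity of `T` excludes failure at a point where `u` vanishes, so there is room to decrease
  -- `u` at `y`.
  have huy : 0 < u y := by
    rcases (hu y).eq_or_lt with h | h
    · exfalso
      rw [← h, mul_zero] at hlt
      exact hlt.not_ge (hTpos u hu y)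
    · exact h
  set D := T (Pi.single y 1) y
  set κ := ν * u y - T u y with hκ
  have hκ0 : 0 < κ := sub_pos.2 hlt
  -- Lowering `u y` by `s` changes the form minus `ν` times the squared norm by `2sκ - s²(ν - D)`,
  -- which maximality forces to be at most `0`. This fails for small `s`.
  have hpert : ∀ s, 0 < s → s ≤ u y → 2 * κ ≤ s * (ν - D) := by
    intro s hs hsu
    set g : ι → ℝ := u - s • Pi.single y 1 with hg
    have hgy : ∀ z, g z = u z - s * (Pi.single y 1 : ι → ℝ) z := fun z => rfl
    have hsing : ∀ F : ι → ℝ, ∑ z, (Pi.single y 1 : ι → ℝ) z * F z = F y := by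
      intro F
      rw [Finset.sum_eq_single y] <;> simp +contextual
    have h1 : ∑ z, g z ^ 2 = 1 - 2 * s * u y + s ^ 2 := by
      have : ∀ z, g z ^ 2 = u z ^ 2 - 2 * s * ((Pi.single y 1 : ι → ℝ) z * u z) +
          s ^ 2 * ((Pi.single y 1 : ι → ℝ) z * (Pi.single y 1 : ι → ℝ) z) := fun z => by
        rw [hgy]; ring
      simp only [this, Finset.sum_add_distrib, Finset.sum_sub_distrib, ← Finset.mul_sum, hsing, hu1]
      simp
    have h2 : ∑ z, g z * T g z = ν - 2 * s * T u y + s ^ 2 * D := by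
      have hTg : ∀ z, T g z = T u z - s * T (Pi.single y 1) z := fun z => by
        rw [hg, map_sub, map_smul]; rfl
      have : ∀ z, g z * T g z = u z * T u z - s * ((Pi.single y 1 : ι → ℝ) z * T u z) -
          s * (u z * T (Pi.single y 1) z) +
          s ^ 2 * ((Pi.single y 1 : ι → ℝ) z * T (Pi.single y 1) z) := fun z => by
        rw [hgy, hTg]; ring
      simp only [this, Finset.sum_add_distrib, Finset.sum_sub_distrib, ← Finset.mul_sum, hsing,
        hT u]
      rw [← hν]
      ring
    have h3 := hall g (fun z => ?_) (fun z hz => ?_)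
    · rw [h1, h2] at h3
      have : s * (2 * κ) ≤ s * (s * (ν - D)) := by rw [hκ]; linarith
      exact le_of_mul_le_mul_left this hs
    · rw [hgy]
      by_cases hzy : z = y
      · subst hzy; simp [hsu]
      · simp [hzy, hu z]
    · have hzy : z ≠ y := fun h => hz (h ▸ hy)
      rw [hgy]
      simp [hzy, huS z hz]
  set s := min (u y) (κ / (|ν - D| + 1)) with hs
  have hs0 : 0 < s := lt_min huy (by positivity)
  have h4 := hpert s hs0 (min_le_left _ _)
  have h5 : s * (|ν - D| + 1) ≤ κ := by
    have : s ≤ κ / (|ν - D| + 1) := min_le_right _ _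
    rwa [le_div_iff₀ (by positivity)] at this
  nlinarith [le_abs_self (ν - D), mul_le_mul_of_nonneg_left (le_abs_self (ν - D)) hs0.le]

end Superharmonic

/-! ### Typical sets of product distributions -/

section ProductFunctions

variable {B : Type*} [Fintype B] {n : ℕ}

theorem sum_prod_apply (g : Fin n → B → ℝ) : ∑ y : Fin n → B, ∏ k, g k (y k) = ∏ k, ∑ b, g k b := by
  classical
  have h := Finset.prod_univ_sum (fun _ : Fin n => (Finset.univ : Finset B)) g
  rw [Fintype.piFinset_univ] at h
  exact h.symm

theorem sum_prod_eq_one {p : B → ℝ} (hp1 : ∑ b, p b = 1) : ∑ y : Fin n → B, ∏ k, p (y k) = 1 := by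
  rw [sum_prod_apply]
  simp [hp1]

/-- The variance of a sum of independent identically distributed centred variables. -/
theorem sum_prod_mul_sum_sq {p X : B → ℝ} (hp1 : ∑ b, p b = 1) (hX : ∑ b, p b * X b = 0) :
    ∑ y : Fin n → B, (∏ k, p (y k)) * (∑ k, X (y k)) ^ 2 = n * ∑ b, p b * X b ^ 2 := by
  have h1 : ∀ i j : Fin n, ∑ y : Fin n → B, (∏ k, p (y k)) * (X (y i) * X (y j)) =
      if i = j then ∑ b, p b * X b ^ 2 else 0 := by
    intro i j
    have h2 : ∀ y : Fin n → B, (∏ k, p (y k)) * (X (y i) * X (y j)) =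
        ∏ k, (p (y k) * ((if k = i then X (y k) else 1) * if k = j then X (y k) else 1)) := by
      intro y
      rw [Finset.prod_mul_distrib, Finset.prod_mul_distrib]
      simp
    simp only [h2]
    rw [sum_prod_apply fun k b => p b * ((if k = i then X b else 1) * if k = j then X b else 1)]
    split_ifs with hij
    · subst hij
      rw [Finset.prod_eq_single i]
      · simp [sq]
      · intro k _ hk
        simp [hk, hp1]
      · simp
    · apply Finset.prod_eq_zero (Finset.mem_univ i)
      simp [hij, hX]
  calc ∑ y : Fin n → B, (∏ k, p (y k)) * (∑ k, X (y k)) ^ 2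
      = ∑ i, ∑ j, ∑ y : Fin n → B, (∏ k, p (y k)) * (X (y i) * X (y j)) := by
        simp only [sq, Finset.sum_mul]
        simp only [Finset.mul_sum]
        rw [Finset.sum_comm]
        exact Finset.sum_congr rfl fun i _ => Finset.sum_comm
    _ = _ := by
        simp [h1]

/-- Chebyshev's inequality for the information content of a product distribution. -/
theorem sum_prod_atypical_le {p : B → ℝ} (hp : ∀ b, 0 < p b) (hp1 : ∑ b, p b = 1) {H w : ℝ}
    (hH : H = ∑ b, Real.negMulLog (p b)) (hw : 0 < w) :
    n * w ^ 2 * ∑ y : Fin n → B with ∏ k, p (y k) < Real.exp (-(n * (H + w))), ∏ k, p (y k) ≤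
      ∑ b, p b * (-Real.log (p b) - H) ^ 2 := by
  rcases Nat.eq_zero_or_pos n with rfl | hn
  · simp only [Nat.cast_zero, zero_mul]
    exact Finset.sum_nonneg fun b _ => mul_nonneg (hp b).le (sq_nonneg _)
  have hn' : (0 : ℝ) < n := by exact_mod_cast hn
  have hX : ∑ b, p b * (-Real.log (p b) - H) = 0 := by
    have : ∀ b, p b * (-Real.log (p b) - H) = Real.negMulLog (p b) - p b * H := fun b => by
      rw [Real.negMulLog]; ring
    rw [Finset.sum_congr rfl fun b _ => this b, Finset.sum_sub_distrib, ← Finset.sum_mul, hp1, hH]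
    ring
  have hvar := sum_prod_mul_sum_sq (n := n) hp1 hX
  have hP : ∀ y : Fin n → B, 0 < ∏ k, p (y k) := fun y => Finset.prod_pos fun k _ => hp _
  have h1 : (n * w) ^ 2 *
      ∑ y : Fin n → B with ∏ k, p (y k) < Real.exp (-(n * (H + w))), ∏ k, p (y k) ≤
      ∑ y : Fin n → B, (∏ k, p (y k)) * (∑ k, (-Real.log (p (y k)) - H)) ^ 2 := by
    rw [Finset.mul_sum]
    refine le_trans (Finset.sum_le_sum fun y hy => ?_) (Finset.sum_le_sum_of_subset_of_nonneg
      (Finset.filter_subset _ _) fun y _ _ => mul_nonneg (hP y).le (sq_nonneg _))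
    rw [mul_comm]
    refine mul_le_mul_of_nonneg_left ?_ (hP y).le
    have h2 : Real.log (∏ k, p (y k)) < -(n * (H + w)) := by
      rw [Real.log_lt_iff_lt_exp (hP y)]
      exact (Finset.mem_filter.1 hy).2
    rw [Real.log_prod fun k _ => (hp _).ne'] at h2
    have h3 : ∑ k, (-Real.log (p (y k)) - H) = -∑ k, Real.log (p (y k)) - n * H := by
      rw [Finset.sum_sub_distrib]
      simp
    rw [h3]
    exact pow_le_pow_left₀ (by positivity) (by linarith) 2
  rw [hvar] at h1
  refine le_of_mul_le_mul_left (le_trans (le_of_eq ?_) h1) hn'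
  ring

/-- Each counted point has mass at least `exp (-c)`, and the total mass is `1`. -/
theorem card_typical_le {p : B → ℝ} (hp : ∀ b, 0 < p b) (hp1 : ∑ b, p b = 1) (c : ℝ) :
    ((Finset.univ.filter fun y : Fin n → B => ¬ ∏ k, p (y k) < Real.exp (-c)).card : ℝ) ≤
      Real.exp c := by
  have hP : ∀ y : Fin n → B, 0 < ∏ k, p (y k) := fun y => Finset.prod_pos fun k _ => hp _
  have h : ((Finset.univ.filter fun y : Fin n → B => ¬ ∏ k, p (y k) < Real.exp (-c)).card : ℝ) *
      Real.exp (-c) ≤ 1 := by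
    rw [← sum_prod_eq_one (n := n) hp1, ← nsmul_eq_mul, ← Finset.sum_const]
    refine le_trans (Finset.sum_le_sum fun y hy => ?_) (Finset.sum_le_sum_of_subset_of_nonneg
      (Finset.filter_subset _ _) fun y _ _ => (hP y).le)
    exact not_lt.1 (Finset.mem_filter.1 hy).2
  calc _ = _ * Real.exp (-c) * Real.exp c := by
        rw [mul_assoc, ← Real.exp_add, neg_add_cancel, Real.exp_zero, mul_one]
    _ ≤ 1 * Real.exp c := mul_le_mul_of_nonneg_right h (Real.exp_pos c).le
    _ = _ := one_mul _

end ProductFunctions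

/-! ### Truncated product functions as trial functions -/

section Trial

theorem stepWeight_neg {q : ℕ} (b : Fin 2 → ZMod q) : stepWeight (-b) = stepWeight b := by
  simp [stepWeight]

variable {q n : ℕ} [NeZero q]

/-- `stepOp` as a linear map. -/
noncomputable def stepLin (q n : ℕ) [NeZero q] :
    (NRTSpace q 2 n → ℝ) →ₗ[ℝ] (NRTSpace q 2 n → ℝ) where
  toFun := stepOp
  map_add' u v := by
    funext y
    simp [stepOp, mul_add, Finset.sum_add_distrib]
  map_smul' c u := by
    funext y
    simp only [stepOp, Pi.smul_apply, smul_eq_mul, Finset.mul_sum, RingHom.id_apply]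
    exact Finset.sum_congr rfl fun _ _ => Finset.sum_congr rfl fun _ _ => by ring

theorem stepLin_apply (u : NRTSpace q 2 n → ℝ) : stepLin q n u = stepOp u := rfl

theorem sum_mul_stepOp_comm (u v : NRTSpace q 2 n → ℝ) :
    ∑ y, u y * stepOp v y = ∑ y, v y * stepOp u y := by
  have h : ∀ u v : NRTSpace q 2 n → ℝ, ∑ y, u y * stepOp v y =
      ∑ k, ∑ b : Fin 2 → ZMod q, stepWeight b * ∑ y, u y * v (y + Pi.single k b) := by
    intro u v
    simp only [stepOp, Finset.mul_sum]
    rw [Finset.sum_comm]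
    refine Finset.sum_congr rfl fun k _ => ?_
    rw [Finset.sum_comm]
    exact Finset.sum_congr rfl fun b _ => Finset.sum_congr rfl fun y _ => by ring
  rw [h, h]
  refine Finset.sum_congr rfl fun k _ => ?_
  rw [← Equiv.sum_comp (Equiv.neg _)]
  refine Finset.sum_congr rfl fun b _ => ?_
  rw [Equiv.neg_apply, stepWeight_neg]
  congr 1
  rw [← Equiv.sum_comp (Equiv.addRight (Pi.single k b))]
  refine Finset.sum_congr rfl fun y _ => ?_
  rw [Equiv.coe_addRight, add_assoc, ← Pi.single_add, add_neg_cancel, Pi.single_zero, add_zero,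
    mul_comm]

theorem sum_stepWeight : ∑ b : Fin 2 → ZMod q, stepWeight b = 2 := by
  have h := sum_stepWeight_char (0 : Fin 2 → ZMod q)
  simp only [Pi.zero_apply, zero_mul, Finset.sum_const_zero, AddChar.map_zero_eq_one, mul_one,
    lastNonzero_zero, Nat.cast_zero, sub_zero] at h
  exact_mod_cast h

/-- The mean eigenvalue per block of the product function built from `ψ`. -/
noncomputable def stepSymbol (ψ : (Fin 2 → ZMod q) → ℝ) : ℝ :=
  ∑ b, stepWeight b * ∑ c, ψ c * ψ (c + b)

/-- A step alters one block; each of the others contributes the factor `∑ ψ² = 1`. -/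
theorem sum_prod_mul_stepOp_prod {ψ : (Fin 2 → ZMod q) → ℝ} (hψ : ∑ b, ψ b ^ 2 = 1) :
    ∑ y : NRTSpace q 2 n, (∏ k, ψ (y k)) * stepOp (fun y => ∏ k, ψ (y k)) y =
      n * stepSymbol ψ := by
  have h : ∀ (k : Fin n) (b : Fin 2 → ZMod q), ∑ y : NRTSpace q 2 n,
      (∏ l, ψ (y l)) * ∏ l, ψ ((y + Pi.single k b : NRTSpace q 2 n) l) = ∑ c, ψ c * ψ (c + b) := by
    intro k b
    simp only [← Finset.prod_mul_distrib]
    refine (sum_prod_apply fun l c => ψ c * ψ (c + (Pi.single k b : NRTSpace q 2 n) l)).trans ?_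
    rw [Finset.prod_eq_single k]
    · simp
    · intro l _ hl
      simp [hl, ← sq, hψ]
    · simp
  simp only [stepOp, Finset.mul_sum]
  rw [Finset.sum_comm]
  have : (n : ℝ) * stepSymbol ψ = ∑ _k : Fin n, stepSymbol ψ := by simp
  rw [this]
  refine Finset.sum_congr rfl fun k _ => ?_
  rw [Finset.sum_comm, stepSymbol]
  refine Finset.sum_congr rfl fun b _ => ?_
  rw [← h k b, Finset.mul_sum]
  exact Finset.sum_congr rfl fun y _ => by ring

/-- A Harnack-type bound: it controls the loss in the quadratic form when the product is truncated.
The `2` is the total mass of `stepWeight`. -/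
theorem stepOp_prod_le {ψ : (Fin 2 → ZMod q) → ℝ} (hψ : ∀ b, 0 < ψ b) {κ : ℝ}
    (hκ : ∀ b c, ψ (c + b) ≤ κ * ψ c) (y : NRTSpace q 2 n) :
    stepOp (fun y => ∏ k, ψ (y k)) y ≤ n * (2 * κ) * ∏ k, ψ (y k) := by
  have h : ∀ (k : Fin n) (b : Fin 2 → ZMod q),
      ∏ l, ψ ((y + Pi.single k b : NRTSpace q 2 n) l) ≤ κ * ∏ l, ψ (y l) := by
    intro k b
    rw [← Finset.mul_prod_erase _ _ (Finset.mem_univ k),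
      ← Finset.mul_prod_erase Finset.univ (fun l => ψ (y l)) (Finset.mem_univ k), ← mul_assoc]
    have he : ∏ l ∈ Finset.univ.erase k, ψ ((y + Pi.single k b : NRTSpace q 2 n) l) =
        ∏ l ∈ Finset.univ.erase k, ψ (y l) :=
      Finset.prod_congr rfl fun l hl => by simp [Finset.ne_of_mem_erase hl]
    rw [he]
    refine mul_le_mul_of_nonneg_right ?_ (Finset.prod_nonneg fun l _ => (hψ _).le)
    simpa using hκ b (y k)
  calc stepOp (fun y => ∏ k, ψ (y k)) y
      ≤ ∑ _k : Fin n, ∑ b : Fin 2 → ZMod q, stepWeight b * (κ * ∏ l, ψ (y l)) :=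
        Finset.sum_le_sum fun k _ => Finset.sum_le_sum fun b _ =>
          mul_le_mul_of_nonneg_left (h k b) (stepWeight_nonneg b)
    _ = _ := by
        simp only [← Finset.sum_mul, sum_stepWeight]
        simp
        ring

/-- A positive function `ψ` on blocks gives, in all large lengths, a small set carrying a
superharmonic function for nearly its symbol. -/
theorem exists_superharmonic_of_symbol {ψ : (Fin 2 → ZMod q) → ℝ} (hψ : ∀ b, 0 < ψ b)
    (hψ1 : ∑ b, ψ b ^ 2 = 1) {H η w : ℝ} (hH : H = ∑ b, Real.negMulLog (ψ b ^ 2)) (hη : 0 < η)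
    (hw : 0 < w) (hsym : η ≤ stepSymbol ψ) :
    ∀ᶠ n : ℕ in atTop, ∃ (S : Finset (NRTSpace q 2 n)) (u : NRTSpace q 2 n → ℝ),
      (∀ y, 0 ≤ u y) ∧ u ≠ 0 ∧ (∀ y ∉ S, u y = 0) ∧
      (∀ y ∈ S, n * (stepSymbol ψ - η) * u y ≤ stepOp u y) ∧
      (S.card : ℝ) ≤ Real.exp (n * (H + w)) := by
  obtain ⟨κ, hκ0, hκ⟩ : ∃ κ : ℝ, 0 < κ ∧ ∀ b c, ψ (c + b) ≤ κ * ψ c := by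
    refine ⟨∑ b, ∑ c, ψ b / ψ c, Finset.sum_pos (fun b _ => Finset.sum_pos
      (fun c _ => div_pos (hψ b) (hψ c)) Finset.univ_nonempty) Finset.univ_nonempty, ?_⟩
    intro b c
    rw [← div_le_iff₀ (hψ c)]
    refine le_trans ?_ (Finset.single_le_sum (f := fun b => ∑ c, ψ b / ψ c) (fun b _ =>
      Finset.sum_nonneg fun c _ => (div_pos (hψ b) (hψ c)).le) (Finset.mem_univ (c + b)))
    exact Finset.single_le_sum (f := fun c' => ψ (c + b) / ψ c')
      (fun c _ => (div_pos (hψ _) (hψ c)).le) (Finset.mem_univ c)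
  set p : (Fin 2 → ZMod q) → ℝ := fun b => ψ b ^ 2 with hp
  have hp0 : ∀ b, 0 < p b := fun b => by have := hψ b; positivity
  set V := ∑ b, p b * (-Real.log (p b) - H) ^ 2 with hV
  -- Chebyshev bounds the atypical mass `P` by `V / (n w²)`. This threshold makes both `4κP ≤ η`,
  -- the allowed loss, and `2P ≤ 1`, which keeps the truncation nonzero.
  have hev : ∀ᶠ n : ℕ in atTop, (V / w ^ 2) * (4 * κ / η + 2) ≤ n :=
    tendsto_natCast_atTop_atTop.eventually_ge_atTop _
  filter_upwards [hev, eventually_gt_atTop 0] with n hn hn0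
  have hn' : (0 : ℝ) < n := by exact_mod_cast hn0
  set f₀ : NRTSpace q 2 n → ℝ := fun y => ∏ k, ψ (y k) with hf₀
  have hf₀pos : ∀ y, 0 < f₀ y := fun y => Finset.prod_pos fun k _ => hψ _
  have hsq : ∀ y : NRTSpace q 2 n, ∏ k, p (y k) = f₀ y ^ 2 := fun y => by
    rw [hf₀, ← Finset.prod_pow]
  set S : Finset (NRTSpace q 2 n) := Finset.univ.filter fun y =>
    ¬ ∏ k, p (y k) < Real.exp (-(n * (H + w))) with hS
  set P := ∑ y : NRTSpace q 2 n with ∏ k, p (y k) < Real.exp (-(n * (H + w))), ∏ k, p (y k) with hP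
  have hcheb : n * w ^ 2 * P ≤ V := sum_prod_atypical_le hp0 hψ1 hH hw
  have hP0 : 0 ≤ P := Finset.sum_nonneg fun y _ => by rw [hsq]; positivity
  have hPle : P * (4 * κ / η + 2) ≤ 1 := by
    have h1 : P * (n * w ^ 2) * (4 * κ / η + 2) ≤ V * (4 * κ / η + 2) := by
      apply mul_le_mul_of_nonneg_right _ (by positivity)
      linarith
    have h2 : V * (4 * κ / η + 2) ≤ n * w ^ 2 := by
      rw [div_mul_eq_mul_div, div_le_iff₀ (by positivity)] at hn
      exact hn
    have h3 : (P * (4 * κ / η + 2)) * (n * w ^ 2) ≤ 1 * (n * w ^ 2) := by linarith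
    exact le_of_mul_le_mul_right h3 (by positivity)
  have hPη : 4 * κ * P ≤ η := by
    have : P * (4 * κ / η) ≤ 1 := by nlinarith
    rw [mul_div_assoc', div_le_one hη] at this
    linarith
  have hPhalf : 2 * P ≤ 1 := by
    have : 0 ≤ P * (4 * κ / η) := by positivity
    nlinarith
  set f : NRTSpace q 2 n → ℝ := fun y => if y ∈ S then f₀ y else 0 with hf
  set g : NRTSpace q 2 n → ℝ := fun y => if y ∈ S then 0 else f₀ y with hg
  have hfg : f₀ = f + g := by
    funext y
    by_cases hy : y ∈ S <;> simp [hf, hg, hy]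
  have hfnn : ∀ y, 0 ≤ f y := fun y => by
    simp only [hf]; split_ifs
    · exact (hf₀pos y).le
    · exact le_rfl
  have hgnn : ∀ y, 0 ≤ g y := fun y => by
    simp only [hg]; split_ifs
    · exact le_rfl
    · exact (hf₀pos y).le
  have hgP : ∑ y, g y * f₀ y = P := by
    rw [hP, Finset.sum_filter]
    refine Finset.sum_congr rfl fun y _ => ?_
    by_cases h : f₀ y ^ 2 < Real.exp (-(n * (H + w)))
    · have hy : y ∉ S := by simp only [hS, Finset.mem_filter, hsq, h]; simp
      simp only [hg, hsq, if_neg hy, if_pos h]; ring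
    · have hy : y ∈ S := by simp only [hS, Finset.mem_filter, hsq, h]; simp
      simp only [hg, hsq, if_pos hy, if_neg h, zero_mul]
  have hf2 : ∑ y, f y ^ 2 = 1 - P := by
    have h1 : ∑ y : NRTSpace q 2 n, f₀ y ^ 2 = 1 := by
      simp only [← hsq]
      exact sum_prod_eq_one hψ1
    rw [← h1, ← hgP, ← Finset.sum_sub_distrib]
    refine Finset.sum_congr rfl fun y _ => ?_
    by_cases hy : y ∈ S <;> simp [hf, hg, hy, sq]
  have hf0 : f ≠ 0 := by
    intro h
    rw [h] at hf2
    simp at hf2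
    linarith
  have hQ : n * (stepSymbol ψ - η) ≤ ∑ y, f y * stepOp f y := by
    have h0 : ∑ y, f₀ y * stepOp f₀ y = n * stepSymbol ψ := sum_prod_mul_stepOp_prod hψ1
    have h1 : ∑ y, g y * stepOp f₀ y ≤ n * (2 * κ) * P := by
      rw [← hgP, Finset.mul_sum]
      refine Finset.sum_le_sum fun y _ => ?_
      have := mul_le_mul_of_nonneg_left (stepOp_prod_le hψ hκ y) (hgnn y)
      linarith
    -- With `f = f₀ - g`, the last term is nonnegative and the middle one loses at most `4κnP`.
    have h2 : ∑ y, f y * stepOp f y = ∑ y, f₀ y * stepOp f₀ y - 2 * ∑ y, g y * stepOp f₀ y +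
        ∑ y, g y * stepOp g y := by
      have hadd : ∀ y, stepOp f₀ y = stepOp f y + stepOp g y := fun y => by
        rw [hfg, ← stepLin_apply, map_add]; rfl
      have hc := sum_mul_stepOp_comm f g
      have h3 : ∀ y, f₀ y * stepOp f₀ y = f y * stepOp f y + f y * stepOp g y + g y * stepOp f y +
          g y * stepOp g y := fun y => by
        rw [hadd, show f₀ y = f y + g y from congrFun hfg y]; ring
      rw [Finset.sum_congr rfl fun y _ => h3 y]
      simp only [hadd, mul_add, Finset.sum_add_distrib]
      rw [hc]
      ring
    have h3 : 0 ≤ ∑ y, g y * stepOp g y :=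
      Finset.sum_nonneg fun y _ => mul_nonneg (hgnn y) (stepOp_nonneg hgnn y)
    rw [h2, h0]
    nlinarith [mul_le_mul_of_nonneg_left hPη hn'.le]
  obtain ⟨u, hu, hu0, huS, huμ⟩ := exists_mul_le_apply (stepLin q n) sum_mul_stepOp_comm
    (fun u hu y => stepOp_nonneg hu y) (S := S) (f := f) hfnn (fun y hy => by simp [hf, hy]) hf0
    (μ := n * (stepSymbol ψ - η)) (by
      rw [hf2]
      refine le_trans ?_ hQ
      have : 0 ≤ n * (stepSymbol ψ - η) := mul_nonneg hn'.le (sub_nonneg.2 hsym)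
      nlinarith)
  exact ⟨S, u, hu, hu0, huS, huμ, card_typical_le hp0 hψ1 _⟩

end Trial

/-! ### From certificates to asymptotic rates -/

/-- In all large lengths `n` there is a set of at most `q ^ (2 n ρ)` vectors of `Q^{2,n}` that
carries a nonnegative function with `stepOp u ≥ n μ u`. -/
def HasCertificate (q : ℕ) [NeZero q] (μ ρ : ℝ) : Prop :=
  ∀ᶠ n : ℕ in atTop, ∃ (S : Finset (NRTSpace q 2 n)) (u : NRTSpace q 2 n → ℝ),
    (∀ y, 0 ≤ u y) ∧ u ≠ 0 ∧ (∀ y ∉ S, u y = 0) ∧ (∀ y ∈ S, n * μ * u y ≤ stepOp u y) ∧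
    (S.card : ℝ) ≤ (q : ℝ) ^ (2 * n * ρ)

section Asymptotics

variable {q : ℕ} [NeZero q] {n M : ℕ → ℕ} {μ ρ δ R : ℝ}

/-- With `L = 2n - d`, the gap `nμ - L` is at least a fixed multiple of `n`, while `2n - L = d` is
`O(n)`. The factor multiplying `|S|` is therefore a constant `K`, and `log K / (2n)` tends to `0`.
-/
theorem eventually_relative_bounds {d : ℕ → ℕ} (hn : Tendsto n atTop atTop)
    (hδ : HasRelativeLimit 2 n d δ) (hμ : 2 - 2 * δ < μ) :
    ∀ᶠ i in atTop, (0 : ℝ) < n i ∧ n i * ((μ - (2 - 2 * δ)) / 2) ≤ n i * μ - (2 * n i - d i) ∧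
      (d i : ℝ) ≤ n i * (2 * (|δ| + 1)) := by
  have h1 : ∀ᶠ i in atTop, δ - (μ - (2 - 2 * δ)) / 4 < d i / (((2 : ℕ) : ℝ) * n i) :=
    hδ.eventually (lt_mem_nhds (by linarith))
  have h2 : ∀ᶠ i in atTop, (d i : ℝ) / (((2 : ℕ) : ℝ) * n i) < |δ| + 1 :=
    hδ.eventually (gt_mem_nhds (by linarith [le_abs_self δ]))
  filter_upwards [h1, h2, hn.eventually (eventually_gt_atTop 0)] with i h1 h2 h3
  have hpos : (0 : ℝ) < n i := by exact_mod_cast h3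
  push_cast at h1 h2
  rw [lt_div_iff₀ (by positivity)] at h1
  rw [div_lt_iff₀ (by positivity)] at h2
  exact ⟨hpos, by linarith, by linarith⟩

theorem tendsto_const_div_two_mul (hn : Tendsto n atTop atTop) (c : ℝ) :
    Tendsto (fun i => c / (((2 : ℕ) : ℝ) * n i)) atTop (𝓝 0) :=
  tendsto_const_nhds.div_atTop ((tendsto_natCast_atTop_atTop.comp hn).const_mul_atTop (by norm_num))

theorem HasCertificate.rate_le (hq : 2 ≤ q) (hc : HasCertificate q μ ρ) (hμ : 2 - 2 * δ < μ)
    {d : ℕ → ℕ} {C : ∀ i, Finset (NRTSpace q 2 (n i))} (hn : Tendsto n atTop atTop)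
    (hC : ∀ i, IsOrderedCode (C i) (M i) (d i)) (hR : HasAsymptoticRate q 2 n M R)
    (hδ : HasRelativeLimit 2 n d δ) : R ≤ ρ := by
  have hq1 : (1 : ℝ) < q := by exact_mod_cast hq
  set ε := (μ - (2 - 2 * δ)) / 2 with hε
  have hε0 : 0 < ε := by rw [hε]; linarith
  set K := 2 * (|δ| + 1) / ε with hK
  have hK0 : 0 < K := by positivity
  have hlim : Tendsto (fun i => Real.logb q K / (((2 : ℕ) : ℝ) * n i) + ρ) atTop (𝓝 ρ) := by
    simpa using (tendsto_const_div_two_mul hn (Real.logb q K)).add_const ρ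
  refine le_of_tendsto_of_tendsto hR hlim ?_
  filter_upwards [eventually_relative_bounds hn hδ hμ, hn.eventually hc]
    with i ⟨hni, h1, h2⟩ ⟨S, u, hu, hu0, huS, huμ, hcard⟩
  have hM0 : (0 : ℝ) < M i := by
    rw [← (hC i).card_eq]; exact_mod_cast (hC i).nonempty.card_pos
  have hlp := card_code_mul_le hu hu0 huS (μ := n i * μ) (L := 2 * n i - d i)
    (by have := (mul_pos hni hε0).trans_le h1; linarith) huμ (hC i).nonempty
    (fun x hx y hy hxy => by
      have : (d i : ℝ) ≤ orderedWeight (x - y) := by exact_mod_cast (hC i).le_dist x hx y hy hxy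
      linarith) (by linarith [(d i).cast_nonneg (α := ℝ)])
  rw [(hC i).card_eq] at hlp
  have h3 : (M i : ℝ) ≤ K * S.card := by
    have h4 : (M i : ℝ) * (n i * ε) ≤ (n i * (2 * (|δ| + 1))) * S.card :=
      (mul_le_mul_of_nonneg_left h1 hM0.le).trans (hlp.trans
        (mul_le_mul_of_nonneg_right (by linarith) (Nat.cast_nonneg _)))
    rw [hK, div_mul_eq_mul_div, le_div_iff₀ hε0]
    exact le_of_mul_le_mul_left (by linarith) hni
  have h5 : Real.logb q (M i) ≤ Real.logb q K + 2 * n i * ρ := by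
    have hqp : 0 < (q : ℝ) ^ (2 * n i * ρ) := Real.rpow_pos_of_pos (by linarith) _
    calc Real.logb q (M i) ≤ Real.logb q (K * (q : ℝ) ^ (2 * n i * ρ)) :=
          Real.logb_le_logb_of_le hq1 hM0 (h3.trans (mul_le_mul_of_nonneg_left hcard hK0.le))
      _ = _ := by
          rw [Real.logb_mul hK0.ne' hqp.ne', Real.logb_rpow (by linarith) (by linarith)]
  push_cast
  rw [div_add' _ _ _ (by positivity)]
  gcongr
  linarith

theorem card_NRTSpace (q n : ℕ) [NeZero q] : Fintype.card (NRTSpace q 2 n) = q ^ (2 * n) := by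
  simp [ZMod.card, pow_mul]

theorem HasCertificate.le_rate (hq : 2 ≤ q) (hc : HasCertificate q μ ρ) (hμ : 2 - 2 * δ < μ)
    {t θ : ℕ → ℕ} {A : ∀ i, Finset (NRTSpace q 2 (n i))} (hn : Tendsto n atTop atTop)
    (hA : ∀ i, IsOOA (A i) (M i) (t i) (θ i)) (hR : HasAsymptoticRate q 2 n M R)
    (hδ : HasRelativeLimit 2 n t δ) : 1 - ρ ≤ R := by
  have hq1 : (1 : ℝ) < q := by exact_mod_cast hq
  set ε := (μ - (2 - 2 * δ)) / 2 with hε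
  have hε0 : 0 < ε := by rw [hε]; linarith
  set K := 2 * (|δ| + 1) / ε with hK
  have hK0 : 0 < K := by positivity
  have hlim : Tendsto (fun i => 1 - (Real.logb q K / (((2 : ℕ) : ℝ) * n i) + ρ)) atTop
      (𝓝 (1 - ρ)) := by
    simpa using ((tendsto_const_div_two_mul hn (Real.logb q K)).add_const ρ).const_sub 1
  refine le_of_tendsto_of_tendsto hlim hR ?_
  filter_upwards [eventually_relative_bounds hn hδ hμ, hn.eventually hc]
    with i ⟨hni, h1, h2⟩ ⟨S, u, hu, hu0, huS, huμ, hcard⟩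
  have hM0 : (0 : ℝ) < M i := by
    rw [← (hA i).card_eq]; exact_mod_cast (hA i).nonempty.card_pos
  have hlp := card_space_mul_le hu hu0 huS (μ := n i * μ) (L := 2 * n i - t i)
    (by have := (mul_pos hni hε0).trans_le h1; linarith) huμ (hA i).nonempty
    (fun x hx => by
      rcases le_or_gt (orderedWeight x) (t i) with h | h
      · exact Or.inl ((hA i).sum_nrtChar_eq_zero hx h)
      · right
        have : (t i : ℝ) ≤ orderedWeight x := by exact_mod_cast h.le
        linarith) (by linarith [(t i).cast_nonneg (α := ℝ)])
  rw [(hA i).card_eq, card_NRTSpace] at hlp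
  push_cast at hlp
  have hqn : (0 : ℝ) < (q : ℝ) ^ (2 * n i) := by positivity
  have h3 : (q : ℝ) ^ (2 * n i) ≤ K * M i * S.card := by
    have h4 : (q : ℝ) ^ (2 * n i) * (n i * ε) ≤ (n i * (2 * (|δ| + 1))) * M i * S.card :=
      (mul_le_mul_of_nonneg_left h1 hqn.le).trans (hlp.trans
        (mul_le_mul_of_nonneg_right (mul_le_mul_of_nonneg_right (by linarith) hM0.le)
          (Nat.cast_nonneg _)))
    rw [hK, div_mul_eq_mul_div, div_mul_eq_mul_div, le_div_iff₀ hε0]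
    exact le_of_mul_le_mul_left (by linarith) hni
  have h5 : (2 * n i : ℝ) ≤ Real.logb q K + Real.logb q (M i) + 2 * n i * ρ := by
    have hqp : 0 < (q : ℝ) ^ (2 * n i * ρ) := Real.rpow_pos_of_pos (by linarith) _
    calc (2 * n i : ℝ) = Real.logb q ((q : ℝ) ^ (2 * n i)) := by
          rw [Real.logb_pow, Real.logb_self_eq_one hq1]; push_cast; ring
      _ ≤ Real.logb q (K * M i * (q : ℝ) ^ (2 * n i * ρ)) :=
          Real.logb_le_logb_of_le hq1 hqn
            (h3.trans (mul_le_mul_of_nonneg_left hcard (mul_pos hK0 hM0).le))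
      _ = _ := by
          rw [Real.logb_mul (mul_pos hK0 hM0).ne' hqp.ne', Real.logb_mul hK0.ne' hM0.ne',
            Real.logb_rpow (by linarith) (by linarith)]
  push_cast
  rw [div_add' _ _ _ (by positivity), one_sub_div (by positivity)]
  gcongr
  linarith

end Asymptotics

/-! ### The Plotkin certificate -/

section Plotkin

variable {q : ℕ} [NeZero q]

/-- A step in one of the `k₀` free blocks always stays in the support, total weight `2`. In any
other block only the zero step does, with weight `1/q + 1/q²`. -/
theorem stepOp_indicator {n k₀ : ℕ} (hk : k₀ ≤ n) {y : NRTSpace q 2 n}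
    (hy : ∀ k : Fin n, k₀ ≤ (k : ℕ) → y k = 0) :
    stepOp (fun y : NRTSpace q 2 n => if ∀ k : Fin n, k₀ ≤ (k : ℕ) → y k = 0 then (1 : ℝ) else 0) y =
      k₀ * 2 + (n - k₀) * (1 / q + 1 / q ^ 2) := by
  have h : ∀ k : Fin n, ∑ b : Fin 2 → ZMod q, stepWeight b *
      (if ∀ l : Fin n, k₀ ≤ (l : ℕ) → (y + Pi.single k b : NRTSpace q 2 n) l = 0 then (1 : ℝ)
        else 0) = if (k : ℕ) < k₀ then 2 else 1 / (q : ℝ) + 1 / q ^ 2 := by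
    intro k
    split_ifs with hk'
    · rw [← sum_stepWeight (q := q)]
      refine Finset.sum_congr rfl fun b _ => ?_
      rw [if_pos, mul_one]
      intro l hl
      have : l ≠ k := fun h => by subst h; omega
      simp [hy l hl, this]
    · have hb : ∀ b : Fin 2 → ZMod q,
          (∀ l : Fin n, k₀ ≤ (l : ℕ) → (y + Pi.single k b : NRTSpace q 2 n) l = 0) ↔ b = 0 := by
        intro b
        constructor
        · intro h
          have := h k (not_lt.1 hk')
          simpa [hy k (not_lt.1 hk')] using this
        · rintro rfl l hl
          simp [hy l hl]
      simp only [hb]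
      rw [Finset.sum_eq_single 0]
      · simp [stepWeight, add_comm]
      · intro b _ hb0
        simp [hb0]
      · simp
  simp only [stepOp, h]
  rw [Finset.sum_ite, Finset.sum_const, Finset.sum_const, nsmul_eq_mul, nsmul_eq_mul]
  have h1 : (Finset.univ.filter fun k : Fin n => (k : ℕ) < k₀).card = k₀ := by
    rw [Fin.card_filter_val_lt]; omega
  have h2 : (Finset.univ.filter fun k : Fin n => ¬ (k : ℕ) < k₀).card = n - k₀ := by
    have := Finset.card_filter_add_card_filter_not (s := (Finset.univ : Finset (Fin n)))
      (fun k : Fin n => (k : ℕ) < k₀)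
    rw [h1, Finset.card_univ, Fintype.card_fin] at this
    omega
  rw [h1, h2, Nat.cast_sub hk]

theorem card_supported {n k₀ : ℕ} (hk : k₀ ≤ n) :
    (Finset.univ.filter fun y : NRTSpace q 2 n => ∀ k : Fin n, k₀ ≤ (k : ℕ) → y k = 0).card =
      q ^ (2 * k₀) := by
  have h : (Finset.univ.filter fun y : NRTSpace q 2 n => ∀ k : Fin n, k₀ ≤ (k : ℕ) → y k = 0) =
      Fintype.piFinset fun k : Fin n => if (k : ℕ) < k₀ then Finset.univ else {0} := by
    ext y
    simp only [Finset.mem_filter, Finset.mem_univ, true_and, Fintype.mem_piFinset]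
    refine forall_congr' fun k => ?_
    split_ifs with hk'
    · simp [hk']
    · simp [not_lt.1 hk']
  rw [h, Fintype.card_piFinset]
  have h1 : ∀ k : Fin n, (if (k : ℕ) < k₀ then Finset.univ else {0} :
      Finset (Fin 2 → ZMod q)).card = if (k : ℕ) < k₀ then q ^ 2 else 1 := by
    intro k
    split_ifs <;> simp [ZMod.card]
  simp only [h1]
  rw [Finset.prod_ite, Finset.prod_const, Finset.prod_const_one, mul_one, Fin.card_filter_val_lt,
    min_eq_right hk, pow_mul]

/-- The certificate of the Plotkin bound: the vectors supported on a fraction `s` of the blocks. -/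
theorem hasCertificate_plotkin (hq : 2 ≤ q) {s η : ℝ} (hs : 0 ≤ s) (hs1 : s ≤ 1) (hη : 0 < η) :
    HasCertificate q (1 / q + 1 / q ^ 2 + s * (2 - (1 / q + 1 / q ^ 2))) (s + η) := by
  have hq1 : (1 : ℝ) < q := by exact_mod_cast hq
  have hev : ∀ᶠ n : ℕ in atTop, 1 / η ≤ n := tendsto_natCast_atTop_atTop.eventually_ge_atTop _
  filter_upwards [hev] with n hn
  have hk : ⌈s * n⌉₊ ≤ n := by
    rw [Nat.ceil_le]
    nlinarith [(Nat.cast_nonneg n : (0 : ℝ) ≤ n)]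
  refine ⟨Finset.univ.filter fun y => ∀ k : Fin n, ⌈s * n⌉₊ ≤ (k : ℕ) → y k = 0,
    fun y => if ∀ k : Fin n, ⌈s * n⌉₊ ≤ (k : ℕ) → y k = 0 then 1 else 0, fun y => ?_, ?_,
    fun y hy => ?_, fun y hy => ?_, ?_⟩
  · simp only
    split_ifs <;> norm_num
  · intro h
    have := congrFun h 0
    simp at this
  · exact if_neg (by simpa using hy)
  · have hy' : ∀ k : Fin n, ⌈s * n⌉₊ ≤ (k : ℕ) → y k = 0 := by simpa using hy
    beta_reduce
    rw [stepOp_indicator hk hy', if_pos hy', mul_one]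
    have h1 : s * n ≤ ⌈s * n⌉₊ := Nat.le_ceil _
    have h2 : 1 / (q : ℝ) + 1 / q ^ 2 ≤ 2 := by
      have : 1 / (q : ℝ) ≤ 1 := by rw [div_le_one (by linarith)]; exact hq1.le
      have : 1 / (q : ℝ) ^ 2 ≤ 1 := by
        rw [div_le_one (by positivity)]; exact one_le_pow₀ hq1.le
      linarith
    nlinarith
  · rw [card_supported hk]
    push_cast
    rw [← Real.rpow_natCast]
    apply Real.rpow_le_rpow_of_exponent_le hq1.le
    have h1 : (⌈s * n⌉₊ : ℝ) < s * n + 1 := Nat.ceil_lt_add_one (by positivity)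
    rw [div_le_iff₀ hη] at hn
    push_cast
    nlinarith

end Plotkin

/-! ### Certificates from distributions of dual weights -/

/-- The mean eigenvalue per block of the product function attached to the distribution
`(p₀, p₁, p₂)` of the dual weights of the blocks. -/
noncomputable def shapeSymbol (q : ℕ) (p₀ p₁ p₂ : ℝ) : ℝ :=
  p₂ + (√p₀ + √((q - 1) * p₁)) ^ 2 / q + (√p₀ + √((q - 1) * p₁) + √(q * (q - 1) * p₂)) ^ 2 / q ^ 2

/-- The entropy of a block whose dual weight has distribution `(p₀, p₁, p₂)` and which is uniform
given its dual weight. -/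
noncomputable def shapeEntropy (q : ℕ) (p₀ p₁ p₂ : ℝ) : ℝ :=
  Real.negMulLog p₀ + (Real.negMulLog p₁ + p₁ * Real.log (q - 1)) +
    (Real.negMulLog p₂ + p₂ * Real.log (q * (q - 1)))

section Shape

/-- The function on blocks with values `A`, `B`, `C` at the blocks of dual weight `0`, `1`, `2`. -/
def blockFun {q : ℕ} (A B C : ℝ) (b : Fin 2 → ZMod q) : ℝ :=
  if b 0 = 0 then (if b 1 = 0 then A else B) else C

theorem comp_blockFun {q : ℕ} (F : ℝ → ℝ) (A B C : ℝ) (b : Fin 2 → ZMod q) :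
    F (blockFun A B C b) = blockFun (F A) (F B) (F C) b := by
  simp only [blockFun]
  split_ifs <;> rfl

variable {q : ℕ} [NeZero q]

theorem sum_zmod_ite (A B : ℝ) : ∑ c : ZMod q, (if c = 0 then A else B) = A + (q - 1) * B := by
  rw [← Finset.add_sum_erase _ _ (Finset.mem_univ (0 : ZMod q)), if_pos rfl]
  congr 1
  rw [Finset.sum_congr rfl fun c hc => if_neg (Finset.ne_of_mem_erase hc), Finset.sum_const,
    Finset.card_erase_of_mem (Finset.mem_univ _), Finset.card_univ, ZMod.card, nsmul_eq_mul,
    Nat.cast_sub (NeZero.one_le (n := q)), Nat.cast_one]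

theorem sum_blockFun_row (A B C : ℝ) (c : ZMod q) :
    ∑ d, blockFun A B C ![c, d] = if c = 0 then A + (q - 1) * B else q * C := by
  have h : ∀ d, blockFun A B C ![c, d] = if c = 0 then (if d = 0 then A else B) else C :=
    fun d => rfl
  simp only [h]
  split_ifs
  · exact sum_zmod_ite A B
  · simp [ZMod.card]

theorem sum_blockFun (A B C : ℝ) :
    ∑ b : Fin 2 → ZMod q, blockFun A B C b = A + (q - 1) * B + q * (q - 1) * C := by
  rw [sum_fin_two_fun]
  simp only [sum_blockFun_row, sum_zmod_ite]
  ring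

/-- One part of `stepWeight` averages over all blocks, the other over the blocks with the same first
entry; each quadratic form is a sum of squares of the corresponding sums. -/
theorem stepSymbol_eq (ψ : (Fin 2 → ZMod q) → ℝ) :
    stepSymbol ψ = (∑ b, ψ b) ^ 2 / q ^ 2 + (∑ c, (∑ d, ψ ![c, d]) ^ 2) / q := by
  have h1 : ∑ b : Fin 2 → ZMod q, ∑ c, ψ c * ψ (c + b) = (∑ b, ψ b) ^ 2 := by
    rw [Finset.sum_comm, sq, Finset.sum_mul]
    refine Finset.sum_congr rfl fun c _ => ?_
    rw [← Finset.mul_sum]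
    congr 1
    exact Equiv.sum_comp (Equiv.addLeft c) ψ
  have h2 : ∑ b : Fin 2 → ZMod q, (if b 0 = 0 then ∑ c, ψ c * ψ (c + b) else 0) =
      ∑ c, (∑ d, ψ ![c, d]) ^ 2 := by
    rw [sum_fin_two_fun]
    change ∑ b₀ : ZMod q, ∑ b₁, (if b₀ = 0 then ∑ c, ψ c * ψ (c + ![b₀, b₁]) else 0) = _
    rw [Finset.sum_comm]
    simp only [Finset.sum_ite_eq', Finset.mem_univ, if_true]
    simp only [sum_fin_two_fun (fun c => ψ c * ψ (c + _))]
    rw [Finset.sum_comm]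
    refine Finset.sum_congr rfl fun c₀ _ => ?_
    rw [Finset.sum_comm, sq, Finset.sum_mul]
    refine Finset.sum_congr rfl fun c₁ _ => ?_
    rw [← Finset.mul_sum]
    congr 1
    refine Eq.trans (Finset.sum_congr rfl fun d _ => ?_)
      (Equiv.sum_comp (Equiv.addLeft c₁) fun d => ψ ![c₀, d])
    simp
  have h3 : ∀ b : Fin 2 → ZMod q, stepWeight b * ∑ c, ψ c * ψ (c + b) =
      (∑ c, ψ c * ψ (c + b)) * (1 / q ^ 2) +
        (if b 0 = 0 then ∑ c, ψ c * ψ (c + b) else 0) * (1 / q) := by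
    intro b
    rw [stepWeight]
    split_ifs <;> ring
  simp only [stepSymbol, h3]
  rw [Finset.sum_add_distrib, ← Finset.sum_mul, ← Finset.sum_mul, h1, h2]
  ring

theorem mul_sqrt_div {a x : ℝ} (ha : 0 < a) : a * √(x / a) = √(a * x) := by
  have : a * x = a ^ 2 * (x / a) := by field_simp
  rw [this, Real.sqrt_mul (sq_nonneg a), Real.sqrt_sq ha.le]

theorem negMulLog_div {a x : ℝ} (ha : 0 < a) (hx : 0 < x) :
    a * Real.negMulLog (x / a) = Real.negMulLog x + x * Real.log a := by
  rw [Real.negMulLog, Real.negMulLog, Real.log_div hx.ne' ha.ne']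
  field_simp
  ring

/-- Every nondegenerate shape distribution gives a certificate. -/
theorem hasCertificate_shape (hq : 2 ≤ q) {p₀ p₁ p₂ μ ρ : ℝ} (h₀ : 0 < p₀) (h₁ : 0 < p₁)
    (h₂ : 0 < p₂) (hp : p₀ + p₁ + p₂ = 1) (hμ0 : 0 ≤ μ) (hμ : μ < shapeSymbol q p₀ p₁ p₂)
    (hρ : shapeEntropy q p₀ p₁ p₂ < 2 * ρ * Real.log q) : HasCertificate q μ ρ := by
  have hq1 : (2 : ℝ) ≤ q := by exact_mod_cast hq
  have hm : (0 : ℝ) < q - 1 := by linarith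
  have hqm : (0 : ℝ) < q * (q - 1) := by nlinarith
  -- There are `1`, `q - 1` and `q(q - 1)` blocks of dual weight `0`, `1` and `2`, and `ψ²` spreads
  -- each mass evenly over its class.
  set ψ : (Fin 2 → ZMod q) → ℝ := blockFun (√p₀) (√(p₁ / (q - 1))) (√(p₂ / (q * (q - 1)))) with hψ
  have hsq : ∀ b : Fin 2 → ZMod q,
      ψ b ^ 2 = blockFun p₀ (p₁ / (q - 1)) (p₂ / (q * (q - 1))) b := by
    intro b
    rw [hψ, comp_blockFun (fun x => x ^ 2), Real.sq_sqrt h₀.le, Real.sq_sqrt (by positivity),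
      Real.sq_sqrt (by positivity)]
  have hpos : ∀ b, 0 < ψ b := by
    intro b
    rw [hψ, blockFun]
    split_ifs <;> positivity
  have hone : ∑ b, ψ b ^ 2 = 1 := by
    simp only [hsq]
    rw [sum_blockFun, mul_div_cancel₀ _ hm.ne', mul_div_cancel₀ _ hqm.ne', hp]
  have hent : shapeEntropy q p₀ p₁ p₂ = ∑ b, Real.negMulLog (ψ b ^ 2) := by
    simp only [hsq]
    simp only [comp_blockFun Real.negMulLog]
    rw [sum_blockFun, negMulLog_div hm h₁, negMulLog_div hqm h₂, shapeEntropy]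
  have hsym : stepSymbol ψ = shapeSymbol q p₀ p₁ p₂ := by
    rw [stepSymbol_eq]
    simp only [hψ]
    rw [sum_blockFun, mul_sqrt_div hm, mul_sqrt_div hqm]
    simp only [sum_blockFun_row, mul_sqrt_div hm]
    have : ∀ c : ZMod q, (if c = 0 then √p₀ + √((q - 1) * p₁)
        else q * √(p₂ / (q * (q - 1)))) ^ 2 = if c = 0 then (√p₀ + √((q - 1) * p₁)) ^ 2
        else q ^ 2 * (p₂ / (q * (q - 1))) := by
      intro c
      split_ifs
      · rfl
      · rw [mul_pow, Real.sq_sqrt (by positivity)]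
    simp only [this, sum_zmod_ite, shapeSymbol]
    field_simp
    ring
  have hlog : 0 < Real.log q := Real.log_pos (by linarith)
  -- All the slack is spent: the symbol minus `η` is `μ`, and the entropy plus `w` is `2ρ log q`.
  have key := exists_superharmonic_of_symbol hpos hone hent (η := shapeSymbol q p₀ p₁ p₂ - μ)
    (w := 2 * ρ * Real.log q - shapeEntropy q p₀ p₁ p₂) (by linarith) (by linarith)
    (by rw [hsym]; linarith)
  filter_upwards [key] with n ⟨S, u, hu, hu0, huS, huμ, hcard⟩
  refine ⟨S, u, hu, hu0, huS, fun y hy => ?_, hcard.trans (le_of_eq ?_)⟩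
  · have := huμ y hy
    rwa [hsym, sub_sub_cancel] at this
  · rw [Real.rpow_def_of_pos (by linarith)]
    congr 1
    ring

end Shape

/-! ### Entropy: chords and chain rules -/

section Entropy

variable {q : ℕ}

theorem entropyq_mul_log (hq : 2 ≤ q) (y : ℝ) :
    entropyq q y * Real.log q =
      Real.negMulLog y + Real.negMulLog (1 - y) + y * Real.log (q - 1) := by
  have hq1 : (2 : ℝ) ≤ q := by exact_mod_cast hq
  have hlog : Real.log q ≠ 0 := (Real.log_pos (by linarith)).ne'
  have h1 : y * Real.log (y / (q - 1)) = y * Real.log y - y * Real.log (q - 1) := by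
    rcases eq_or_ne y 0 with rfl | hy
    · simp
    · rw [Real.log_div hy (by linarith)]; ring
  rw [entropyq, Real.logb, Real.logb, Real.negMulLog, Real.negMulLog]
  field_simp
  linarith

theorem concaveOn_entropyq (hq : 2 ≤ q) : ConcaveOn ℝ (Set.Icc 0 1) (entropyq q) := by
  have hq1 : (2 : ℝ) ≤ q := by exact_mod_cast hq
  have hlog : 0 < Real.log q := Real.log_pos (by linarith)
  refine ⟨convex_Icc 0 1, fun x hx y hy a b ha hb hab => ?_⟩
  have hc := Real.concaveOn_negMulLog
  have h1 := hc.2 (Set.mem_Ici.2 hx.1) (Set.mem_Ici.2 hy.1) ha hb hab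
  have h2 := hc.2 (Set.mem_Ici.2 (sub_nonneg.2 hx.2)) (Set.mem_Ici.2 (sub_nonneg.2 hy.2)) ha hb hab
  simp only [smul_eq_mul] at h1 h2 ⊢
  have h3 : a * (1 - x) + b * (1 - y) = 1 - (a * x + b * y) := by linear_combination hab
  rw [h3] at h2
  refine le_of_mul_le_mul_right ?_ hlog
  rw [add_mul, mul_assoc, mul_assoc, entropyq_mul_log hq, entropyq_mul_log hq, entropyq_mul_log hq]
  linarith

theorem chord_le_entropyq (hq : 2 ≤ q) {x₁ x₂ x L₁ L₂ : ℝ} (h0 : 0 ≤ x₁) (h1 : x₁ ≤ x) (h2 : x ≤ x₂)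
    (h3 : x₂ ≤ 1) (h12 : x₁ < x₂) (hL₁ : L₁ ≤ entropyq q x₁) (hL₂ : L₂ ≤ entropyq q x₂) :
    (x₂ - x) * L₁ + (x - x₁) * L₂ ≤ (x₂ - x₁) * entropyq q x := by
  have hd : 0 < x₂ - x₁ := sub_pos.2 h12
  have hne := hd.ne'
  have hA : 0 ≤ (x₂ - x) / (x₂ - x₁) := div_nonneg (by linarith) hd.le
  have hB : 0 ≤ (x - x₁) / (x₂ - x₁) := div_nonneg (by linarith) hd.le
  have hAB : (x₂ - x) / (x₂ - x₁) + (x - x₁) / (x₂ - x₁) = 1 := by field_simp; ring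
  have h := (concaveOn_entropyq hq).2 (⟨h0, by linarith⟩ : x₁ ∈ Set.Icc (0 : ℝ) 1)
    (⟨by linarith, h3⟩ : x₂ ∈ Set.Icc (0 : ℝ) 1) hA hB hAB
  simp only [smul_eq_mul] at h
  have hx : (x₂ - x) / (x₂ - x₁) * x₁ + (x - x₁) / (x₂ - x₁) * x₂ = x := by field_simp; ring
  rw [hx] at h
  have h4 := mul_le_mul_of_nonneg_left h hd.le
  have h5 : (x₂ - x₁) * ((x₂ - x) / (x₂ - x₁) * entropyq q x₁ + (x - x₁) / (x₂ - x₁) * entropyq q x₂)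
      = (x₂ - x) * entropyq q x₁ + (x - x₁) * entropyq q x₂ := by field_simp
  rw [h5] at h4
  have h6 := mul_le_mul_of_nonneg_left hL₁ (sub_nonneg.2 h2)
  have h7 := mul_le_mul_of_nonneg_left hL₂ (sub_nonneg.2 h1)
  linarith

theorem entropyq_zero (q : ℕ) : entropyq q 0 = 0 := by
  simp [entropyq]

theorem entropyq_max (hq : 2 ≤ q) : entropyq q (((q : ℝ) - 1) / q) = 1 := by
  have hq1 : (2 : ℝ) ≤ q := by exact_mod_cast hq
  have hlog : 0 < Real.log q := Real.log_pos (by linarith)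
  refine mul_right_cancel₀ hlog.ne' ?_
  have h1 : 1 - ((q : ℝ) - 1) / q = 1 / q := by field_simp; ring
  rw [entropyq_mul_log hq, h1, Real.negMulLog, Real.negMulLog, Real.log_div (by linarith)
    (by linarith), Real.log_div one_ne_zero (by linarith), Real.log_one]
  field_simp
  ring

/-- The chord of the entropy between `0` and its maximum. -/
theorem mul_div_le_entropyq (hq : 2 ≤ q) {x : ℝ} (h0 : 0 ≤ x) (h1 : x ≤ ((q : ℝ) - 1) / q) :
    q / (q - 1) * x ≤ entropyq q x := by
  have hq1 : (2 : ℝ) ≤ q := by exact_mod_cast hq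
  have ha : 0 < ((q : ℝ) - 1) / q := div_pos (by linarith) (by linarith)
  have h := chord_le_entropyq hq le_rfl h0 h1 (by rw [div_le_one (by linarith)]; linarith) ha
    (entropyq_zero q).ge (entropyq_max hq).ge
  rw [mul_zero, zero_add, sub_zero, sub_zero, mul_one, div_mul_eq_mul_div,
    le_div_iff₀ (by linarith)] at h
  rw [div_mul_eq_mul_div, div_le_iff₀ (by linarith)]
  linarith

/-- `3⁵ = 243 ≤ 256 = 2⁸`. Both sharper entropy values needed for `q = 2` and `q = 3` reduce to
this. -/
theorem five_log_three_le : 5 * Real.log 3 ≤ 8 * Real.log 2 := by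
  have h : Real.log ((3 : ℝ) ^ 5) ≤ Real.log ((2 : ℝ) ^ 8) :=
    Real.log_le_log (by norm_num) (by norm_num)
  rwa [Real.log_pow, Real.log_pow] at h

theorem entropyq_two_quarter : 4 / 5 ≤ entropyq 2 (1 / 4) := by
  have hlog : 0 < Real.log 2 := Real.log_pos (by norm_num)
  refine le_of_mul_le_mul_right ?_ hlog
  have h := entropyq_mul_log (le_refl 2) (1 / 4)
  have h4 : Real.log 4 = 2 * Real.log 2 := by
    rw [show (4 : ℝ) = 2 ^ 2 by norm_num, Real.log_pow]; norm_num
  norm_num [Real.negMulLog] at h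
  rw [show (1 / 4 : ℝ) = 4⁻¹ by norm_num] at *
  rw [h, Real.log_div (by norm_num) (by norm_num), Real.log_inv, h4]
  linarith [five_log_three_le]

theorem entropyq_three_half : 15 / 16 ≤ entropyq 3 (1 / 2) := by
  have hlog : 0 < Real.log 3 := Real.log_pos (by norm_num)
  refine le_of_mul_le_mul_right ?_ hlog
  have h := entropyq_mul_log (show 2 ≤ 3 by norm_num) (1 / 2)
  norm_num [Real.negMulLog] at h
  rw [show (1 / 2 : ℝ) = 2⁻¹ by norm_num] at *
  rw [h, Real.log_inv]
  linarith [five_log_three_le]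

/-- The chain rule for the entropy of a shape distribution, revealing the dual weight `1` first. -/
theorem shapeEntropy_eq_rate (hq : 2 ≤ q) {τ : ℝ × ℝ} (h1 : τ.1 < 1) :
    shapeEntropy q (1 - τ.1 - τ.2) τ.1 τ.2 = 2 * rateExponent q τ * Real.log q := by
  have hq1 : (2 : ℝ) ≤ q := by exact_mod_cast hq
  set x := τ.2 / (1 - τ.1) with hx
  have hs : 1 - τ.1 ≠ 0 := by linarith
  have e2 : τ.2 = (1 - τ.1) * x := by rw [hx]; field_simp
  have e0 : 1 - τ.1 - τ.2 = (1 - τ.1) * (1 - x) := by rw [mul_sub, ← e2]; ring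
  have h2 : 2 * rateExponent q τ * Real.log q = τ.2 * Real.log q + entropyq q τ.1 * Real.log q +
      (1 - τ.1) * (entropyq q x * Real.log q) := by
    rw [rateExponent]; ring
  rw [h2, entropyq_mul_log hq, entropyq_mul_log hq, shapeEntropy, e0, Real.negMulLog_mul,
    Real.log_mul (by linarith) (by linarith)]
  have h3 : Real.negMulLog τ.2 = x * Real.negMulLog (1 - τ.1) + (1 - τ.1) * Real.negMulLog x := by
    conv_lhs => rw [e2, Real.negMulLog_mul]
  rw [h3]
  have h4 : τ.2 * Real.log (q - 1) = (1 - τ.1) * (x * Real.log (q - 1)) := by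
    conv_lhs => rw [e2]
    ring
  linarith

/-- The chain rule for the entropy of a shape distribution, revealing the dual weight `2` first. -/
theorem shapeEntropy_eq (hq : 2 ≤ q) {y t : ℝ} (h1 : t < 1) :
    shapeEntropy q (1 - y - t) y t =
      (t + entropyq q t + (1 - t) * entropyq q (y / (1 - t))) * Real.log q := by
  have hq1 : (2 : ℝ) ≤ q := by exact_mod_cast hq
  set x := y / (1 - t) with hx
  have hs : 1 - t ≠ 0 := by linarith
  have e2 : y = (1 - t) * x := by rw [hx]; field_simp
  have e0 : 1 - y - t = (1 - t) * (1 - x) := by rw [mul_sub, ← e2]; ring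
  rw [add_mul, add_mul, mul_assoc, entropyq_mul_log hq, entropyq_mul_log hq, shapeEntropy, e0,
    Real.negMulLog_mul, Real.log_mul (by linarith) (by linarith)]
  have h3 : Real.negMulLog y = x * Real.negMulLog (1 - t) + (1 - t) * Real.negMulLog x := by
    conv_lhs => rw [e2, Real.negMulLog_mul]
  rw [h3]
  have h4 : y * Real.log (q - 1) = (1 - t) * (x * Real.log (q - 1)) := by
    conv_lhs => rw [e2]
    ring
  linarith

/-- Equating the two chain rules swaps the roles of `τ₁` and `τ₂`, so that the entropy of `t` stands
alone and can be bounded by a chord. -/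
theorem two_mul_rateExponent (hq : 2 ≤ q) {y t : ℝ} (hy : y < 1) (ht : t < 1) :
    2 * rateExponent q (y, t) = t + entropyq q t + (1 - t) * entropyq q (y / (1 - t)) := by
  have hlog : 0 < Real.log q := Real.log_pos (by exact_mod_cast (by omega : 1 < q))
  refine mul_right_cancel₀ hlog.ne' ?_
  rw [← shapeEntropy_eq hq ht]
  exact (shapeEntropy_eq_rate hq (τ := (y, t)) hy).symm

theorem continuous_shapeEntropy (q : ℕ) :
    Continuous fun p : ℝ × ℝ × ℝ => shapeEntropy q p.1 p.2.1 p.2.2 := by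
  unfold shapeEntropy
  have := Real.continuous_negMulLog
  fun_prop

theorem continuous_krawtchoukGamma (q : ℕ) : Continuous (krawtchoukGamma q) := by
  unfold krawtchoukGamma
  fun_prop

end Entropy

/-! ### The function `γ` -/

section Gamma

variable {q : ℕ}

theorem mul_one_sub_krawtchoukGamma (hq : 2 ≤ q) {y : ℝ} (h0 : 0 ≤ y) (h1 : y ≤ 1) :
    q * (1 - krawtchoukGamma q y) = (√(1 - y) + √((q - 1) * y)) ^ 2 := by
  have hq1 : (2 : ℝ) ≤ q := by exact_mod_cast hq
  have hm : (0 : ℝ) ≤ (q - 1) * y := mul_nonneg (by linarith) h0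
  rw [add_sq, Real.sq_sqrt (sub_nonneg.2 h1), Real.sq_sqrt hm, mul_assoc,
    ← Real.sqrt_mul (sub_nonneg.2 h1), krawtchoukGamma, mul_comm (1 - y)]
  field_simp
  ring

/-- A weighted inequality of arithmetic and geometric means. -/
theorem sqrt_add_sqrt_sq_le {A B c : ℝ} (hA : 0 ≤ A) (hB : 0 ≤ B) (hc : 0 < c) :
    (√A + √B) ^ 2 ≤ A * (1 + 1 / c) + B * (1 + c) := by
  have h : 0 ≤ (√A - c * √B) ^ 2 / c := by positivity
  have e : (√A - c * √B) ^ 2 / c = √A ^ 2 * (1 / c) - 2 * √A * √B + c * √B ^ 2 := by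
    field_simp
    ring
  rw [e, Real.sq_sqrt hA, Real.sq_sqrt hB] at h
  rw [add_sq, Real.sq_sqrt hA, Real.sq_sqrt hB]
  linarith

theorem krawtchoukGamma_nonneg (hq : 2 ≤ q) {y : ℝ} (h0 : 0 ≤ y) (h1 : y ≤ 1) :
    0 ≤ krawtchoukGamma q y := by
  have hq1 : (2 : ℝ) ≤ q := by exact_mod_cast hq
  have h := mul_one_sub_krawtchoukGamma hq h0 h1
  have h2 := sqrt_add_sqrt_sq_le (sub_nonneg.2 h1) (mul_nonneg (by linarith : (0 : ℝ) ≤ q - 1) h0)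
    -- This `c` gives equality at `y = (q - 1)/q`, the zero of `γ`.
    (c := 1 / (q - 1)) (by apply one_div_pos.2; linarith)
  rw [← h, one_div_one_div] at h2
  have h3 : (1 - y) * (1 + ((q : ℝ) - 1)) + (q - 1) * y * (1 + 1 / (q - 1)) = q := by
    have : (q : ℝ) - 1 ≠ 0 := by linarith
    field_simp
    ring
  rw [h3] at h2
  by_contra! h4
  nlinarith

theorem krawtchoukGamma_pos (hq : 2 ≤ q) {y : ℝ} (h0 : 0 ≤ y) (h1 : y ≤ ((q : ℝ) - 1) / q ^ 2) :
    0 < krawtchoukGamma q y := by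
  have hq1 : (2 : ℝ) ≤ q := by exact_mod_cast hq
  rw [le_div_iff₀ (by positivity)] at h1
  have hy1 : y ≤ 1 := by nlinarith
  have h := mul_one_sub_krawtchoukGamma hq h0 hy1
  have h2 := sqrt_add_sqrt_sq_le (sub_nonneg.2 hy1) (mul_nonneg (by linarith : (0 : ℝ) ≤ q - 1) h0)
    one_pos
  rw [← h] at h2
  have h3 : (1 - y) * (1 + 1 / 1) + ((q : ℝ) - 1) * y * (1 + 1) = 2 + 2 * (q - 2) * y := by ring
  rw [h3] at h2
  -- The mean inequality with `c = 1` gives `2 + 2(q - 2)y`, which is below `q` for `q ≥ 3` but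
  -- equals `q` for `q = 2`. There strictness comes from `y(1 - y) < 1/4`.
  rcases eq_or_lt_of_le (show (2 : ℝ) ≤ q from hq1) with hq2 | hq2
  · rw [← hq2, show (2 - 1 : ℝ) * y = y by ring] at h
    rw [← hq2] at h1
    have h5 : √(1 - y) * √y < 1 / 2 := by
      rw [← Real.sqrt_mul (by linarith), Real.sqrt_lt' (by norm_num)]
      nlinarith
    have h6 : (√(1 - y) + √y) ^ 2 < 2 := by
      rw [add_sq, Real.sq_sqrt (by linarith), Real.sq_sqrt (by linarith)]
      linarith
    linarith
  · have h5 : ((q : ℝ) - 2) * y < q - 2 := by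
      have : y < 1 / 2 := by nlinarith
      nlinarith
    have h6 : (3 : ℝ) ≤ q := by
      have : 2 < q := by exact_mod_cast hq2
      exact_mod_cast this
    have h7 : 2 * (q - 2) * y < (q : ℝ) - 2 := by
      have : y < 1 / 2 := by nlinarith
      nlinarith
    nlinarith

end Gamma

/-! ### Comparing the symbol with the constraint -/

section Symbol

/-- After division by `√s` this compares `√(1 - x) + √((Q - 1)x)` at `x = y` and at `x = y/s ≥ y`.
That function increases on `[0, (Q - 1)/Q]`, which contains `y/s ≤ Qy`. -/
theorem sqrt_add_sqrt_ge {Q s y : ℝ} (hQ : 2 ≤ Q) (hy0 : 0 ≤ y) (hy : y * Q ^ 2 ≤ Q - 1)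
    (hs : 1 ≤ s * Q) (hs1 : s ≤ 1) :
    √s * (√(1 - y) + √((Q - 1) * y)) ≤ √(s - y) + √((Q - 1) * y) := by
  have hs0 : 0 < s := by by_contra! h; nlinarith
  have hr := Real.sqrt_nonneg s
  have hr2 := Real.sq_sqrt hs0.le
  have hr1 : √s ≤ 1 := by rw [Real.sqrt_le_one]; exact hs1
  have hys : y * Q ≤ s * (Q - 1) := by nlinarith
  have hsy : 0 ≤ s - y := by nlinarith
  have h1y : 0 ≤ 1 - y := by nlinarith
  set r := √s
  set P := √(1 - y) with hP
  set B := √(s - y) with hB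
  set R := √((Q - 1) * y) with hR
  have hP2 : P ^ 2 = 1 - y := Real.sq_sqrt h1y
  have hB2 : B ^ 2 = s - y := Real.sq_sqrt hsy
  have hR2 : R ^ 2 = (Q - 1) * y := Real.sq_sqrt (mul_nonneg (by linarith) hy0)
  have hP0 : 0 ≤ P := Real.sqrt_nonneg _
  have hB0 : 0 ≤ B := Real.sqrt_nonneg _
  have hR0 : 0 ≤ R := Real.sqrt_nonneg _
  set ω := √Q with hω
  have hω2 : ω ^ 2 = Q := Real.sq_sqrt (by linarith)
  have hω0 : 0 < ω := Real.sqrt_pos.2 (by linarith)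
  have hrω : 1 ≤ r * ω := by
    rw [hω, ← Real.sqrt_mul hs0.le, Real.one_le_sqrt]
    exact hs
  have hω1 : 1 ≤ ω := by rw [hω, Real.one_le_sqrt]; linarith
  have hBω : r ≤ B * ω := by
    rw [hB, hω, ← Real.sqrt_mul hsy]
    exact Real.sqrt_le_sqrt (by nlinarith)
  have hPω : r ≤ r * P * ω := by
    have : 1 ≤ P * ω := by
      rw [hP, hω, ← Real.sqrt_mul h1y, Real.one_le_sqrt]
      nlinarith
    nlinarith
  by_contra! hlt
  have h1 : R * (1 - r) < r * P - B := by linarith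
  -- Multiplying by the conjugate exposes the factor `1 - r`, which cancels against the assumed
  -- failure.
  have h2 : (r * P - B) * (r * P + B) = y * (1 - r) * (1 + r) := by
    have : (r * P - B) * (r * P + B) = r ^ 2 * P ^ 2 - B ^ 2 := by ring
    rw [this, hr2, hP2, hB2]
    linear_combination y * hr2
  have hAB : 0 < r * P + B := by
    have : 0 < (r * P + B) * ω := by nlinarith
    exact pos_of_mul_pos_left this hω0.le
  have h3 : R * (1 - r) * (r * P + B) < y * (1 - r) * (1 + r) := by
    rw [← h2]
    exact mul_lt_mul_of_pos_right h1 hAB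
  have hr1' : 0 < 1 - r := by
    rcases hr1.eq_or_lt with h | h
    · rw [h] at h3; simp at h3
    · linarith
  have h4 : R * (r * P + B) < y * (1 + r) := by
    refine lt_of_mul_lt_mul_left ?_ hr1'.le
    linarith
  have hRy : y * Q ≤ R := by
    rw [hR]
    apply Real.le_sqrt_of_sq_le
    nlinarith
  have h5 : 1 + r ≤ Q * (r * P + B) := by
    have h6 : ω * (r + r) ≤ ω * (r * P * ω + B * ω) :=
      mul_le_mul_of_nonneg_left (add_le_add hPω hBω) hω0.le
    have h7 : r * 1 ≤ r * ω := mul_le_mul_of_nonneg_left hω1 hr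
    have h8 : ω * (r * P * ω + B * ω) = Q * (r * P + B) := by rw [← hω2]; ring
    linarith
  have h9 := mul_le_mul_of_nonneg_right hRy hAB.le
  have h10 := mul_le_mul_of_nonneg_left h5 hy0
  linarith

variable {q : ℕ}

/-- The square root of `1 - γ(y)`. -/
noncomputable def krawtchoukRoot (q : ℕ) (y : ℝ) : ℝ := (√(1 - y) + √((q - 1) * y)) / √q

theorem krawtchoukRoot_nonneg (q : ℕ) (y : ℝ) : 0 ≤ krawtchoukRoot q y := by
  unfold krawtchoukRoot; positivity

theorem mul_krawtchoukRoot_sq (hq : 2 ≤ q) (y : ℝ) :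
    q * krawtchoukRoot q y ^ 2 = (√(1 - y) + √((q - 1) * y)) ^ 2 := by
  have hq1 : (2 : ℝ) ≤ q := by exact_mod_cast hq
  rw [krawtchoukRoot, div_pow, Real.sq_sqrt (by linarith)]
  field_simp

theorem krawtchoukRoot_sq (hq : 2 ≤ q) {y : ℝ} (h0 : 0 ≤ y) (h1 : y ≤ 1) :
    krawtchoukRoot q y ^ 2 = 1 - krawtchoukGamma q y := by
  have hq1 : (2 : ℝ) ≤ q := by exact_mod_cast hq
  refine mul_left_cancel₀ (show (q : ℝ) ≠ 0 by linarith) ?_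
  rw [mul_krawtchoukRoot_sq hq, mul_one_sub_krawtchoukGamma hq h0 h1]

/-- Let `v = √(1 - γ(y))`, `r = √(1 - t)`, `b = √((q - 1)t)`. By `sqrt_add_sqrt_ge` the symbol is at
least `t + (rv)² + (rv + b)²/q`. Its excess over the left side factors as `(1 - v) r / q` times an
expression that `hE` makes nonnegative; the second alternative of `hE` is the squared form of that
sign condition. -/
theorem le_shapeSymbol (hq : 2 ≤ q) {y t : ℝ} (hy0 : 0 ≤ y) (hy : y ≤ ((q : ℝ) - 1) / q ^ 2)
    (ht0 : 0 ≤ t) (ht : t ≤ ((q : ℝ) - 1) / q)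
    (hE : 1 ≤ (1 - t) * (1 + krawtchoukRoot q y) ∨
      4 * ((q : ℝ) - 1) * (1 - (1 - t) * (1 + krawtchoukRoot q y)) ^ 2 ≤
        (q - 2) ^ 2 * (1 + krawtchoukRoot q y) ^ 2 * (1 - t) * t) :
    (2 - krawtchoukGamma q t) * (1 - (1 - t) * krawtchoukGamma q y) ≤
      shapeSymbol q (1 - y - t) y t := by
  have hq1 : (2 : ℝ) ≤ q := by exact_mod_cast hq
  rw [le_div_iff₀ (by positivity)] at hy
  rw [le_div_iff₀ (by positivity)] at ht
  have hy1 : y ≤ 1 := by nlinarith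
  have ht1 : t ≤ 1 := by nlinarith
  have hge := sqrt_add_sqrt_ge hq1 hy0 hy (s := 1 - t) (by linarith) (by linarith)
  have hv0 := krawtchoukRoot_nonneg q y
  have hv2 := krawtchoukRoot_sq hq hy0 hy1
  have hγt := mul_one_sub_krawtchoukGamma hq ht0 ht1
  have hγy0 := krawtchoukGamma_nonneg hq hy0 hy1
  set v := krawtchoukRoot q y with hv
  have hω : 0 < √(q : ℝ) := Real.sqrt_pos.2 (by linarith)
  have hω2 : √(q : ℝ) ^ 2 = q := Real.sq_sqrt (by linarith)
  have hvω : √(1 - y) + √((q - 1) * y) = √q * v := by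
    rw [hv, krawtchoukRoot]; field_simp
  rw [hvω] at hge
  have hr0 : 0 ≤ √(1 - t) := Real.sqrt_nonneg _
  have hr2 : √(1 - t) ^ 2 = 1 - t := Real.sq_sqrt (by linarith)
  have hb0 : 0 ≤ √((q - 1) * t) := Real.sqrt_nonneg _
  have hb2 : √((q - 1) * t) ^ 2 = (q - 1) * t := Real.sq_sqrt (by nlinarith)
  have hsplit : √(q * (q - 1) * t) = √q * √((q - 1) * t) := by
    rw [mul_assoc, Real.sqrt_mul (by linarith)]
  have hsub : 1 - y - t = 1 - t - y := by ring
  rw [shapeSymbol, hsplit, hsub]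
  set α := √(1 - t - y) + √((q - 1) * y) with hα
  set r := √(1 - t)
  set b := √((q - 1) * t)
  set ω := √(q : ℝ)
  have hv1 : v ≤ 1 := by nlinarith
  have hE' : 0 ≤ r * t * (q - 2) * (1 + v) + 2 * b * ((1 - t) * (1 + v) - 1) := by
    rcases hE with h | h
    · have : 0 ≤ r * t * (q - 2) * (1 + v) := by
        have : (0 : ℝ) ≤ q - 2 := by linarith
        positivity
      have : 0 ≤ 2 * b * ((1 - t) * (1 + v) - 1) := mul_nonneg (by positivity) (by linarith)
      linarith
    · have h1 : (2 * b * (1 - (1 - t) * (1 + v))) ^ 2 ≤ (r * t * (q - 2) * (1 + v)) ^ 2 := by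
        have e1 : (2 * b * (1 - (1 - t) * (1 + v))) ^ 2 =
            t * (4 * ((q : ℝ) - 1) * (1 - (1 - t) * (1 + v)) ^ 2) := by
          rw [mul_pow, mul_pow, hb2]; ring
        have e2 : (r * t * (q - 2) * (1 + v)) ^ 2 =
            t * ((q - 2) ^ 2 * (1 + v) ^ 2 * (1 - t) * t) := by
          rw [mul_pow, mul_pow, mul_pow, hr2]; ring
        rw [e1, e2]
        exact mul_le_mul_of_nonneg_left h ht0
      have h2 : 0 ≤ r * t * (q - 2) * (1 + v) := by
        have : (0 : ℝ) ≤ q - 2 := by linarith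
        positivity
      have := abs_le_of_sq_le_sq h1 h2
      linarith [le_abs_self (2 * b * (1 - (1 - t) * (1 + v)))]
  have hc : (2 - krawtchoukGamma q t) * (1 - (1 - t) * krawtchoukGamma q y) =
      (1 + (r + b) ^ 2 / q) * (1 - (1 - t) * (1 - v ^ 2)) := by
    rw [← hγt, hv2]
    field_simp
    ring
  set A := α / ω with hA
  have hαA : α = ω * A := by rw [hA]; field_simp
  have hAv : r * v ≤ A := by
    rw [hA, le_div_iff₀ hω]
    linarith
  have e1 : α ^ 2 / q = A ^ 2 := by rw [hαA, mul_pow, hω2]; field_simp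
  have e2 : (α + ω * b) ^ 2 / q ^ 2 = (A + b) ^ 2 / q := by
    rw [hαA, ← mul_add, mul_pow, hω2]; field_simp
  rw [hc, e1, e2]
  have hrv : 0 ≤ r * v := mul_nonneg hr0 hv0
  have h1 : (r * v) ^ 2 ≤ A ^ 2 := pow_le_pow_left₀ hrv hAv 2
  have h2 : (r * v + b) ^ 2 / q ≤ (A + b) ^ 2 / q := by gcongr
  refine le_trans ?_ (add_le_add (add_le_add (le_refl t) h1) h2)
  rw [← sub_nonneg]
  have key : t + (r * v) ^ 2 + (r * v + b) ^ 2 / q -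
      (1 + (r + b) ^ 2 / q) * (1 - (1 - t) * (1 - v ^ 2)) =
      (1 - v) * r * (r * t * (q - 2) * (1 + v) + 2 * b * ((1 - t) * (1 + v) - 1)) / q := by
    field_simp
    have ht' : t = 1 - r ^ 2 := by linarith
    have hb2' : b ^ 2 = (q - 1) * (1 - r ^ 2) := by rw [hb2, ht']
    rw [ht']
    linear_combination (1 - v ^ 2) * r ^ 2 * hb2'
  rw [key]
  have : 0 ≤ 1 - v := by linarith
  positivity

end Symbol

/-! ### Polynomial conditions for the two certificates -/

section Dichotomy

/-- The sign condition propagates upwards in `s` and `v`, so it need only be checked at one rational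
point. -/
theorem symbol_condition_of_ge {Q s v s₀ v₀ : ℝ} (hQ : 2 ≤ Q) (hs₀ : 0 ≤ s₀) (hv₀ : 0 ≤ v₀)
    (hs : s₀ ≤ s) (hv : v₀ ≤ v)
    (h : 4 * (Q - 1) * (1 - s₀ * (1 + v₀)) ^ 2 ≤
      (Q - 2) ^ 2 * (s₀ * (1 + v₀)) * (1 + v₀ - s₀ * (1 + v₀))) :
    1 ≤ s * (1 + v) ∨
      4 * (Q - 1) * (1 - s * (1 + v)) ^ 2 ≤ (Q - 2) ^ 2 * (1 + v) ^ 2 * s * (1 - s) := by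
  by_contra! hcon
  obtain ⟨hx1, hlt⟩ := hcon
  have e : (Q - 2) ^ 2 * (1 + v) ^ 2 * s * (1 - s) =
      (Q - 2) ^ 2 * (s * (1 + v)) * (1 + v - s * (1 + v)) := by ring
  rw [e] at hlt
  have hx0 : s₀ * (1 + v₀) ≤ s * (1 + v) := by
    apply mul_le_mul hs (by linarith) (by linarith) (by linarith)
  have hx00 : 0 ≤ s₀ * (1 + v₀) := by positivity
  set x := s * (1 + v)
  set x₀ := s₀ * (1 + v₀)
  set K := (Q - 2) ^ 2 with hK
  have hK0 : 0 ≤ K := sq_nonneg _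
  have h1 : K * x * (1 + v₀ - x) ≤ K * x * (1 + v - x) :=
    mul_le_mul_of_nonneg_left (by linarith) (mul_nonneg hK0 (hx00.trans hx0))
  -- Concavity of this quadratic in `x`, written out: it is nonnegative at `x₀` and equals `K v₀` at
  -- `1`, hence is nonnegative between.
  have key : (1 - x₀) * (K * x * (1 + v₀ - x) - 4 * (Q - 1) * (1 - x) ^ 2) =
      (1 - x) * (K * x₀ * (1 + v₀ - x₀) - 4 * (Q - 1) * (1 - x₀) ^ 2) +
      (x - x₀) * (K * v₀) + (K + 4 * (Q - 1)) * (x - x₀) * (1 - x) * (1 - x₀) := by ring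
  have h2 : 0 ≤ (1 - x₀) * (K * x * (1 + v₀ - x) - 4 * (Q - 1) * (1 - x) ^ 2) := by
    rw [key]
    have a1 : 0 ≤ (1 - x) * (K * x₀ * (1 + v₀ - x₀) - 4 * (Q - 1) * (1 - x₀) ^ 2) :=
      mul_nonneg (by linarith) (by linarith)
    have a2 : 0 ≤ (x - x₀) * (K * v₀) := mul_nonneg (by linarith) (by positivity)
    have a3 : 0 ≤ (K + 4 * (Q - 1)) * (x - x₀) * (1 - x) * (1 - x₀) :=
      mul_nonneg (mul_nonneg (mul_nonneg (by linarith) (by linarith)) (by linarith)) (by linarith)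
    linarith
  have h3 := nonneg_of_mul_nonneg_right h2 (by linarith)
  linarith

/-- With `s = 1 - t` and `v² = 1 - γ(y)`, the conclusion is the Plotkin alternative after bounding
`2 - γ(t)` by `2` and both entropies by chords from `0`. Once `v²` is bounded linearly in `y`, `h1`
compares the constant terms and `h2` the coefficients of `y`. -/
theorem plotkin_condition_of_le {Q s y v s₀ c : ℝ} (hQ : 2 ≤ Q) (hy : 0 ≤ y)
    (hs : s ≤ s₀) (hs₀ : 0 ≤ s₀) (hv1 : 1 ≤ Q * v ^ 2)
    (hv : Q * v ^ 2 ≤ (1 - y) * (1 + 1 / c) + (Q - 1) * y * (1 + c))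
    (h1 : s₀ * (4 * Q * (1 + 1 / c) - 1) ≤ 2 * Q + 1)
    (h2 : s₀ * (4 * ((Q - 1) * (1 + c) - (1 + 1 / c))) ≤ 2 * Q + 1) :
    s * (4 * Q ^ 2 * v ^ 2 - 1) ≤ (2 * Q + 1) * (1 + Q * y) := by
  have h3 : s * (4 * Q ^ 2 * v ^ 2 - 1) ≤ s₀ * (4 * Q ^ 2 * v ^ 2 - 1) :=
    mul_le_mul_of_nonneg_right hs (by nlinarith)
  have h4 : s₀ * (4 * Q ^ 2 * v ^ 2 - 1) ≤
      s₀ * (4 * Q * ((1 - y) * (1 + 1 / c) + (Q - 1) * y * (1 + c)) - 1) :=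
    mul_le_mul_of_nonneg_left (by nlinarith) hs₀
  have h5 := mul_le_mul_of_nonneg_right h2 (mul_nonneg (by linarith : 0 ≤ Q) hy)
  linarith

theorem plotkin_condition_of_le' {Q s y v s₀ v₁ : ℝ} (hQ : 2 ≤ Q) (hy : 0 ≤ y)
    (hs : s ≤ s₀) (hs₀ : 0 ≤ s₀) (hv1 : 1 ≤ Q * v ^ 2) (hv0 : 0 ≤ v) (hv : v ≤ v₁)
    (h1 : s₀ * (4 * Q ^ 2 * v₁ ^ 2 - 1) ≤ 2 * Q + 1) :
    s * (4 * Q ^ 2 * v ^ 2 - 1) ≤ (2 * Q + 1) * (1 + Q * y) := by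
  have h3 : s * (4 * Q ^ 2 * v ^ 2 - 1) ≤ s₀ * (4 * Q ^ 2 * v ^ 2 - 1) :=
    mul_le_mul_of_nonneg_right hs (by nlinarith)
  have h4 : s₀ * (4 * Q ^ 2 * v ^ 2 - 1) ≤ s₀ * (4 * Q ^ 2 * v₁ ^ 2 - 1) := by
    have := pow_le_pow_left₀ hv0 hv 2
    gcongr
  have h5 : 0 ≤ (2 * Q + 1) * (Q * y) := by positivity
  linarith

theorem le_of_mul_sq_le {Q v v₀ : ℝ} (hv0 : 0 ≤ v) (hQ : 0 < Q) (hv1 : 1 ≤ Q * v ^ 2)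
    (h : Q * v₀ ^ 2 ≤ 1) : v₀ ≤ v := by
  by_contra! hlt
  nlinarith

/-- Either the product certificate or the Plotkin certificate is good enough, for `4 ≤ q`. -/
theorem symbol_or_plotkin_condition {q : ℕ} (hq : 4 ≤ q) {s y v : ℝ} (hy : 0 ≤ y)
    (hv0 : 0 ≤ v) (hv1 : 1 ≤ (q : ℝ) * v ^ 2)
    (hv : ∀ c : ℝ, 0 < c → (q : ℝ) * v ^ 2 ≤ (1 - y) * (1 + 1 / c) + (q - 1) * y * (1 + c)) :
    (1 ≤ s * (1 + v) ∨ 4 * ((q : ℝ) - 1) * (1 - s * (1 + v)) ^ 2 ≤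
      (q - 2) ^ 2 * (1 + v) ^ 2 * s * (1 - s)) ∨
    s * (4 * (q : ℝ) ^ 2 * v ^ 2 - 1) ≤ (2 * q + 1) * (1 + q * y) := by
  have hq4 : (4 : ℝ) ≤ q := by exact_mod_cast hq
  have hq0 : (0 : ℝ) < q := by linarith
  have hq2 : (2 : ℝ) ≤ q := by linarith
  have large : ∀ s₀ v₀ c : ℝ, 0 ≤ s₀ → 0 ≤ v₀ → v₀ ≤ v → 0 < c →
      4 * ((q : ℝ) - 1) * (1 - s₀ * (1 + v₀)) ^ 2 ≤
        (q - 2) ^ 2 * (s₀ * (1 + v₀)) * (1 + v₀ - s₀ * (1 + v₀)) →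
      s₀ * (4 * q * (1 + 1 / c) - 1) ≤ 2 * q + 1 →
      s₀ * (4 * ((q - 1) * (1 + c) - (1 + 1 / c))) ≤ 2 * q + 1 →
      (1 ≤ s * (1 + v) ∨ 4 * ((q : ℝ) - 1) * (1 - s * (1 + v)) ^ 2 ≤
        (q - 2) ^ 2 * (1 + v) ^ 2 * s * (1 - s)) ∨
      s * (4 * (q : ℝ) ^ 2 * v ^ 2 - 1) ≤ (2 * q + 1) * (1 + q * y) := by
    intro s₀ v₀ c hs₀ hv₀ hvv hc h1 h2 h3
    rcases le_total s₀ s with h | h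
    · exact Or.inl (symbol_condition_of_ge hq2 hs₀ hv₀ h hvv h1)
    · exact Or.inr (plotkin_condition_of_le hq2 hy h hs₀ hv1 (hv c hc) h2 h3)
  have small : ∀ s₀ v₀ v₁ : ℝ, 0 ≤ s₀ → 0 ≤ v₀ → (q : ℝ) * v₀ ^ 2 ≤ 1 → v ≤ v₁ →
      4 * ((q : ℝ) - 1) * (1 - s₀ * (1 + v₀)) ^ 2 ≤
        (q - 2) ^ 2 * (s₀ * (1 + v₀)) * (1 + v₀ - s₀ * (1 + v₀)) →
      s₀ * (4 * (q : ℝ) ^ 2 * v₁ ^ 2 - 1) ≤ 2 * q + 1 →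
      (1 ≤ s * (1 + v) ∨ 4 * ((q : ℝ) - 1) * (1 - s * (1 + v)) ^ 2 ≤
        (q - 2) ^ 2 * (1 + v) ^ 2 * s * (1 - s)) ∨
      s * (4 * (q : ℝ) ^ 2 * v ^ 2 - 1) ≤ (2 * q + 1) * (1 + q * y) := by
    intro s₀ v₀ v₁ hs₀ hv₀ hvv hvv1 h1 h2
    rcases le_total s₀ s with h | h
    · exact Or.inl (symbol_condition_of_ge hq2 hs₀ hv₀ h (le_of_mul_sq_le hv0 hq0 hv1 hvv) h1)
    · exact Or.inr (plotkin_condition_of_le' hq2 hy h hs₀ hv1 hv0 hvv1 h2)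
  -- At each threshold `s₀` the symbol condition holds for `s ≥ s₀` and the Plotkin condition for `s
  -- ≤ s₀`. The values `v₀` are rational lower bounds for `1/√q`, or for `v` itself after a case
  -- split; `c` tunes the linear upper bound of `v²`.
  rcases le_or_gt 15 q with h15 | h15
  · have : (15 : ℝ) ≤ q := by exact_mod_cast h15
    exact large (1 / 4) 0 1 (by norm_num) le_rfl hv0 one_pos (by nlinarith) (by linarith)
      (by linarith)
  have h15' : (q : ℝ) ≤ 15 := by exact_mod_cast h15.le
  rcases le_or_gt 9 q with h9 | h9
  · have : (9 : ℝ) ≤ q := by exact_mod_cast h9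
    exact large (13 / 50) (1 / 4) (6 / 5) (by norm_num) (by norm_num)
      (le_of_mul_sq_le hv0 hq0 hv1 (by linarith)) (by norm_num) (by nlinarith)
      (by linarith) (by linarith)
  interval_cases q
  · rcases le_total v (3 / 5) with h | h
    · exact small (2 / 5) (1 / 2) (3 / 5) (by norm_num) (by norm_num) (by norm_num) h
        (by norm_num) (by norm_num)
    · exact large (9 / 25) (3 / 5) (8 / 5) (by norm_num) (by norm_num) h (by norm_num)
        (by norm_num) (by norm_num) (by norm_num)
  · rcases le_total v (11 / 20) with h | h
    · exact small (17 / 50) (447 / 1000) (11 / 20) (by norm_num) (by norm_num) (by norm_num) h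
        (by norm_num) (by norm_num)
    · exact large (8 / 25) (11 / 20) (7 / 5) (by norm_num) (by norm_num) h (by norm_num)
        (by norm_num) (by norm_num) (by norm_num)
  · exact large (61 / 200) (51 / 125) (5 / 4) (by norm_num) (by norm_num)
      (le_of_mul_sq_le hv0 hq0 hv1 (by norm_num)) (by norm_num) (by norm_num) (by norm_num)
      (by norm_num)
  · exact large (7 / 25) (377 / 1000) (6 / 5) (by norm_num) (by norm_num)
      (le_of_mul_sq_le hv0 hq0 hv1 (by norm_num)) (by norm_num) (by norm_num) (by norm_num)
      (by norm_num)
  · exact large (7 / 25) (353 / 1000) (6 / 5) (by norm_num) (by norm_num)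
      (le_of_mul_sq_le hv0 hq0 hv1 (by norm_num)) (by norm_num) (by norm_num) (by norm_num)
      (by norm_num)

variable {q : ℕ}

/-- The comparison of the rate with the Plotkin line, from lower bounds `A`, `B` of the entropies
of the two steps of the chain rule. -/
theorem plotkin_le_rate (hq : 2 ≤ q) {y t A B : ℝ} (hy0 : 0 ≤ y)
    (hy : y ≤ ((q : ℝ) - 1) / q ^ 2) (ht0 : 0 ≤ t) (ht : t ≤ ((q : ℝ) - 1) / q)
    (hA : A ≤ entropyq q t) (hB : B ≤ (1 - t) * entropyq q (y / (1 - t)))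
    (h : 4 * (q : ℝ) ^ 2 * (1 - (1 - t) * (1 - krawtchoukRoot q y ^ 2)) - 2 * (q + 1) ≤
      ((q : ℝ) - 1) * (2 * q + 1) * (t + A + B)) :
    (2 - krawtchoukGamma q t) * (1 - (1 - t) * krawtchoukGamma q y) - (1 / q + 1 / q ^ 2) ≤
      rateExponent q (y, t) * (2 - (1 / (q : ℝ) + 1 / q ^ 2)) := by
  have hq1 : (2 : ℝ) ≤ q := by exact_mod_cast hq
  rw [le_div_iff₀ (by positivity)] at hy
  rw [le_div_iff₀ (by positivity)] at ht
  have hy1 : y < 1 := by nlinarith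
  have ht1 : t < 1 := by nlinarith
  have hr := two_mul_rateExponent hq hy1 ht1
  have hγt := krawtchoukGamma_nonneg hq ht0 ht1.le
  rw [krawtchoukRoot_sq hq hy0 hy1.le] at h
  have hv : 1 - krawtchoukGamma q y = krawtchoukRoot q y ^ 2 :=
    (krawtchoukRoot_sq hq hy0 hy1.le).symm
  have hγ1 : krawtchoukGamma q y ≤ 1 := by nlinarith [sq_nonneg (krawtchoukRoot q y)]
  have hγ0 := krawtchoukGamma_nonneg hq hy0 hy1.le
  have h1 : 0 ≤ 1 - (1 - t) * krawtchoukGamma q y := by nlinarith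
  -- Dropping `γ(t)` is affordable here and leaves a condition linear in `t`, apart from the
  -- entropies.
  have h2 : (2 - krawtchoukGamma q t) * (1 - (1 - t) * krawtchoukGamma q y) ≤
      2 * (1 - (1 - t) * krawtchoukGamma q y) := by nlinarith
  have h3 : (2 * (1 - (1 - t) * krawtchoukGamma q y) - (1 / q + 1 / q ^ 2)) * (2 * q ^ 2) ≤
      rateExponent q (y, t) * (2 - (1 / (q : ℝ) + 1 / q ^ 2)) * (2 * q ^ 2) := by
    have e1 : (2 * (1 - (1 - t) * krawtchoukGamma q y) - (1 / q + 1 / q ^ 2)) * (2 * (q : ℝ) ^ 2) =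
        4 * (q : ℝ) ^ 2 * (1 - (1 - t) * krawtchoukGamma q y) - 2 * (q + 1) := by
      field_simp
      ring
    have e2 : rateExponent q (y, t) * (2 - (1 / (q : ℝ) + 1 / q ^ 2)) * (2 * q ^ 2) =
        ((q : ℝ) - 1) * (2 * q + 1) * (2 * rateExponent q (y, t)) := by
      field_simp
      ring
    rw [e1, e2, hr]
    rw [show 1 - (1 - krawtchoukGamma q y) = krawtchoukGamma q y by ring] at h
    refine h.trans (mul_le_mul_of_nonneg_left (by linarith) (by nlinarith))
  have h4 := le_of_mul_le_mul_right h3 (by positivity)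
  linarith

end Dichotomy

/-! ### Every feasible pair is covered by one of the certificates -/

section Comparison

theorem symbol_or_plotkin_of_four_le {q : ℕ} (hq : 4 ≤ q) {y t : ℝ} (hy0 : 0 ≤ y)
    (hy : y ≤ ((q : ℝ) - 1) / q ^ 2) (ht0 : 0 ≤ t) (ht : t ≤ ((q : ℝ) - 1) / q)
    (hv1 : 1 ≤ (q : ℝ) * krawtchoukRoot q y ^ 2)
    (hv : ∀ c : ℝ, 0 < c → (q : ℝ) * krawtchoukRoot q y ^ 2 ≤
      (1 - y) * (1 + 1 / c) + (q - 1) * y * (1 + c)) :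
    (1 ≤ (1 - t) * (1 + krawtchoukRoot q y) ∨
      4 * ((q : ℝ) - 1) * (1 - (1 - t) * (1 + krawtchoukRoot q y)) ^ 2 ≤
        (q - 2) ^ 2 * (1 + krawtchoukRoot q y) ^ 2 * (1 - t) * t) ∨
    (2 - krawtchoukGamma q t) * (1 - (1 - t) * krawtchoukGamma q y) - (1 / q + 1 / q ^ 2) ≤
      rateExponent q (y, t) * (2 - (1 / (q : ℝ) + 1 / q ^ 2)) := by
  have hq1 : (4 : ℝ) ≤ q := by exact_mod_cast hq
  have hq2 : 2 ≤ q := by omega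
  have hm : (q : ℝ) - 1 ≠ 0 := by linarith
  have ht' := ht
  have hy' := hy
  rw [le_div_iff₀ (by positivity)] at hy'
  rw [le_div_iff₀ (by positivity)] at ht'
  have hs : 0 < 1 - t := by nlinarith
  rcases symbol_or_plotkin_condition hq (s := 1 - t) hy0 (krawtchoukRoot_nonneg q y) hv1 hv
    with h | h
  · left
    rwa [show 1 - (1 - t) = t by ring] at h
  · right
    have hx : y / (1 - t) ≤ ((q : ℝ) - 1) / q := by
      rw [div_le_div_iff₀ hs (by linarith)]
      nlinarith
    have hB := mul_le_mul_of_nonneg_left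
      (mul_div_le_entropyq hq2 (div_nonneg hy0 hs.le) hx) hs.le
    refine plotkin_le_rate hq2 hy0 hy ht0 ht (mul_div_le_entropyq hq2 ht0 ht) hB ?_
    have e : ((q : ℝ) - 1) * (2 * q + 1) *
        (t + q / (q - 1) * t + (1 - t) * (q / (q - 1) * (y / (1 - t)))) =
        (q - 1) * (2 * q + 1) * t + q * (2 * q + 1) * (t + y) := by
      have := hs.ne'
      field_simp
      ring
    rw [e]
    linarith

theorem symbol_or_plotkin_three {y t : ℝ} (hy0 : 0 ≤ y)
    (hy : y ≤ (((3 : ℕ) : ℝ) - 1) / ((3 : ℕ) : ℝ) ^ 2) (ht0 : 0 ≤ t)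
    (ht : t ≤ (((3 : ℕ) : ℝ) - 1) / (3 : ℕ))
    (hv1 : 1 ≤ ((3 : ℕ) : ℝ) * krawtchoukRoot 3 y ^ 2)
    (hv : ∀ c : ℝ, 0 < c → ((3 : ℕ) : ℝ) * krawtchoukRoot 3 y ^ 2 ≤
      (1 - y) * (1 + 1 / c) + ((3 : ℕ) - 1) * y * (1 + c)) :
    (1 ≤ (1 - t) * (1 + krawtchoukRoot 3 y) ∨
      4 * (((3 : ℕ) : ℝ) - 1) * (1 - (1 - t) * (1 + krawtchoukRoot 3 y)) ^ 2 ≤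
        ((3 : ℕ) - 2) ^ 2 * (1 + krawtchoukRoot 3 y) ^ 2 * (1 - t) * t) ∨
    (2 - krawtchoukGamma 3 t) * (1 - (1 - t) * krawtchoukGamma 3 y) -
        (1 / (3 : ℕ) + 1 / ((3 : ℕ) : ℝ) ^ 2) ≤
      rateExponent 3 (y, t) * (2 - (1 / ((3 : ℕ) : ℝ) + 1 / (3 : ℕ) ^ 2)) := by
  rw [or_iff_not_imp_left]
  intro hE
  have hy' := hy
  have ht' := ht
  norm_num at hy' ht' hv1
  have hv0 := krawtchoukRoot_nonneg 3 y
  have hv14 := hv (7 / 5) (by norm_num)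
  norm_num at hv14
  set v := krawtchoukRoot 3 y
  have cond : ∀ s₀ v₀ : ℝ, 0 ≤ s₀ → 0 ≤ v₀ → v₀ ≤ v →
      4 * (((3 : ℕ) : ℝ) - 1) * (1 - s₀ * (1 + v₀)) ^ 2 ≤
        (((3 : ℕ) : ℝ) - 2) ^ 2 * (s₀ * (1 + v₀)) * (1 + v₀ - s₀ * (1 + v₀)) → 1 - t < s₀ := by
    intro s₀ v₀ h1 h2 h3 h4
    by_contra! h5
    apply hE
    have := symbol_condition_of_ge (by norm_num) h1 h2 h5 h3 h4
    rwa [show 1 - (1 - t) = t by ring] at this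
  have hvlow : 577 / 1000 ≤ v := le_of_mul_sq_le hv0 (by norm_num) hv1 (by norm_num)
  have hs47 : 1 - t < 47 / 100 := cond _ (577 / 1000) (by norm_num) (by norm_num) hvlow
    (by norm_num)
  -- Since `t > 53/100`, the steeper chord from `0` can be replaced by the one over `[1/2, 2/3]`.
  have hA : 3 / 4 + 3 / 8 * t ≤ entropyq 3 t := by
    have h := chord_le_entropyq (show 2 ≤ 3 by norm_num) (x₁ := 1 / 2) (x := t)
      (x₂ := (((3 : ℕ) : ℝ) - 1) / (3 : ℕ)) (by norm_num) (by linarith) ht (by norm_num)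
      (by norm_num) entropyq_three_half (entropyq_max (by norm_num)).ge
    norm_num at h
    linarith
  have hs : 0 < 1 - t := by linarith
  have hx : y / (1 - t) ≤ (((3 : ℕ) : ℝ) - 1) / (3 : ℕ) := by
    rw [div_le_div_iff₀ hs (by norm_num)]
    norm_num
    linarith
  have hB := mul_le_mul_of_nonneg_left
    (mul_div_le_entropyq (show 2 ≤ 3 by norm_num) (div_nonneg hy0 hs.le) hx) hs.le
  refine plotkin_le_rate (by norm_num) hy0 hy ht0 ht hA hB ?_
  have e : (1 - t) * (((3 : ℕ) : ℝ) / ((3 : ℕ) - 1) * (y / (1 - t))) = 3 / 2 * y := by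
    have := hs.ne'
    field_simp
    norm_num
    ring
  rw [e]
  norm_num
  rcases le_total v (3 / 4) with h | h
  · have h2 : v ^ 2 ≤ 9 / 16 := by nlinarith
    have h3 := mul_le_mul_of_nonneg_left h2 hs.le
    linarith
  · have h3 := cond (41 / 100) (3 / 4) (by norm_num) (by norm_num) h (by norm_num)
    have h4 : 0 ≤ 36 * v ^ 2 - 67 / 4 := by nlinarith
    have h5 := mul_le_mul_of_nonneg_right h3.le h4
    linarith

/-- For `q = 2` the factor `(q - 2)²` kills the second form of the sign condition, so only `1 ≤ (1 -
t)(1 + v)` is available. Its negation is used to eliminate `1 - t`: the target is multiplied by `1 +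
v`. -/
theorem symbol_or_plotkin_two {y t : ℝ} (hy0 : 0 ≤ y)
    (hy : y ≤ (((2 : ℕ) : ℝ) - 1) / ((2 : ℕ) : ℝ) ^ 2) (ht0 : 0 ≤ t)
    (ht : t ≤ (((2 : ℕ) : ℝ) - 1) / (2 : ℕ))
    (hv1 : 1 ≤ ((2 : ℕ) : ℝ) * krawtchoukRoot 2 y ^ 2)
    (hv : ∀ c : ℝ, 0 < c → ((2 : ℕ) : ℝ) * krawtchoukRoot 2 y ^ 2 ≤
      (1 - y) * (1 + 1 / c) + ((2 : ℕ) - 1) * y * (1 + c)) :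
    1 ≤ (1 - t) * (1 + krawtchoukRoot 2 y) ∨
    (2 - krawtchoukGamma 2 t) * (1 - (1 - t) * krawtchoukGamma 2 y) -
        (1 / (2 : ℕ) + 1 / ((2 : ℕ) : ℝ) ^ 2) ≤
      rateExponent 2 (y, t) * (2 - (1 / ((2 : ℕ) : ℝ) + 1 / (2 : ℕ) ^ 2)) := by
  rw [or_iff_not_imp_left, not_le]
  intro hE
  have hy' := hy
  have ht' := ht
  norm_num at hy' ht' hv1
  have hv0 := krawtchoukRoot_nonneg 2 y
  have hv4 := hv 4 (by norm_num)
  have hv18 := hv (9 / 5) (by norm_num)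
  norm_num at hv4 hv18
  set v := krawtchoukRoot 2 y
  have hvlow : 7 / 10 ≤ v := le_of_mul_sq_le hv0 (by norm_num) hv1 (by norm_num)
  have hs : 0 < 1 - t := by linarith
  have hs2 : (1 - t) * (17 / 10) < 1 := by nlinarith
  have hA : 3 / 5 + 4 / 5 * t ≤ entropyq 2 t := by
    have h := chord_le_entropyq le_rfl (x₁ := 1 / 4) (x := t)
      (x₂ := (((2 : ℕ) : ℝ) - 1) / (2 : ℕ)) (by norm_num) (by linarith) ht (by norm_num)
      (by norm_num) entropyq_two_quarter (entropyq_max (by norm_num)).ge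
    norm_num at h
    linarith
  have hσ : (1 - t) * (y / (1 - t)) = y := mul_div_cancel₀ _ hs.ne'
  have hσ0 : 0 ≤ y / (1 - t) := div_nonneg hy0 hs.le
  have hvup : v ≤ 81 / 100 + 6 / 5 * y := by
    refine le_of_sq_le_sq ?_ (by linarith)
    nlinarith
  rcases le_total (y / (1 - t)) (1 / 4) with h4 | h4
  · have hB : 16 / 5 * y ≤ (1 - t) * entropyq 2 (y / (1 - t)) := by
      have h := chord_le_entropyq le_rfl (x₁ := 0) (x := y / (1 - t)) (x₂ := 1 / 4) le_rfl hσ0 h4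
        (by norm_num) (by norm_num) (entropyq_zero 2).ge entropyq_two_quarter
      have := mul_le_mul_of_nonneg_left h hs.le
      linarith
    refine plotkin_le_rate le_rfl hy0 hy ht0 ht hA hB ?_
    norm_num
    have h5 : 0 ≤ 16 * v ^ 2 - 7 := by nlinarith
    have h6 : 16 * v ^ 2 - 7 ≤ (2 + 16 * y) * (1 + v) := by
      have : v ≤ 1 := by nlinarith
      nlinarith
    have h7 : (1 - t) * (16 * v ^ 2 - 7) * (1 + v) ≤ (2 + 16 * y) * (1 + v) := by
      have := mul_le_mul_of_nonneg_right hE.le h5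
      linarith
    have h8 := le_of_mul_le_mul_right h7 (by linarith)
    linarith
  · have hσ1 : y / (1 - t) ≤ 1 / 2 := by
      rw [div_le_iff₀ hs]; linarith
    have hB : 3 / 5 * (1 - t) + 4 / 5 * y ≤ (1 - t) * entropyq 2 (y / (1 - t)) := by
      have h := chord_le_entropyq le_rfl (x₁ := 1 / 4) (x := y / (1 - t))
        (x₂ := (((2 : ℕ) : ℝ) - 1) / (2 : ℕ)) (by norm_num) h4 (by norm_num; linarith)
        (by norm_num) (by norm_num) entropyq_two_quarter (entropyq_max (by norm_num)).ge
      norm_num at h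
      have := mul_le_mul_of_nonneg_left h hs.le
      linarith
    refine plotkin_le_rate le_rfl hy0 hy ht0 ht hA hB ?_
    norm_num
    -- From `y ≥ (1 - t)/4` and `t ≤ 1/2`.
    have hy8 : 1 / 8 ≤ y := by
      rw [le_div_iff₀ hs] at h4
      linarith
    have h9 : (1 - t) * (16 * v ^ 2 - 10) ≤ 2 + 4 * y := by
      rcases le_total (16 * v ^ 2 - 10) 0 with h5 | h5
      · have := mul_nonpos_of_nonneg_of_nonpos hs.le h5
        linarith
      · have h6 : 16 * v ^ 2 - 10 ≤ (2 + 4 * y) * (1 + v) := by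
          rcases le_total v (9 / 10) with h | h
          · nlinarith
          · nlinarith
        have h7 : (1 - t) * (16 * v ^ 2 - 10) * (1 + v) ≤ (2 + 4 * y) * (1 + v) := by
          have := mul_le_mul_of_nonneg_right hE.le h5
          linarith
        exact le_of_mul_le_mul_right h7 (by linarith)
    linarith

/-- Each feasible pair is matched by the product certificate of its shape or by the Plotkin
certificate of its rate. -/
theorem le_shapeSymbol_or_le_rate {q : ℕ} (hq : 2 ≤ q) {y t : ℝ} (hy0 : 0 ≤ y)
    (hy : y ≤ ((q : ℝ) - 1) / q ^ 2) (ht0 : 0 ≤ t) (ht : t ≤ ((q : ℝ) - 1) / q) :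
    (2 - krawtchoukGamma q t) * (1 - (1 - t) * krawtchoukGamma q y) ≤
      shapeSymbol q (1 - y - t) y t ∨
    (2 - krawtchoukGamma q t) * (1 - (1 - t) * krawtchoukGamma q y) - (1 / q + 1 / q ^ 2) ≤
      rateExponent q (y, t) * (2 - (1 / (q : ℝ) + 1 / q ^ 2)) := by
  have hq1 : (2 : ℝ) ≤ q := by exact_mod_cast hq
  have hy' := hy
  rw [le_div_iff₀ (by positivity)] at hy'
  have hy1 : y ≤ 1 := by nlinarith
  have hmy : 0 ≤ ((q : ℝ) - 1) * y := mul_nonneg (by linarith) hy0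
  have hv1 : 1 ≤ (q : ℝ) * krawtchoukRoot q y ^ 2 := by
    rw [mul_krawtchoukRoot_sq hq, add_sq, Real.sq_sqrt (by linarith), Real.sq_sqrt hmy]
    have : 0 ≤ 2 * √(1 - y) * √((q - 1) * y) := by positivity
    nlinarith
  have hv : ∀ c : ℝ, 0 < c → (q : ℝ) * krawtchoukRoot q y ^ 2 ≤
      (1 - y) * (1 + 1 / c) + (q - 1) * y * (1 + c) := fun c hc => by
    rw [mul_krawtchoukRoot_sq hq]
    exact sqrt_add_sqrt_sq_le (by linarith) hmy hc
  rcases le_or_gt 4 q with h4 | h4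
  · exact (symbol_or_plotkin_of_four_le h4 hy0 hy ht0 ht hv1 hv).imp_left
      (le_shapeSymbol hq hy0 hy ht0 ht)
  · interval_cases q
    · exact (symbol_or_plotkin_two hy0 hy ht0 ht hv1 hv).imp_left fun h =>
        le_shapeSymbol hq hy0 hy ht0 ht (Or.inl h)
    · exact (symbol_or_plotkin_three hy0 hy ht0 ht hv1 hv).imp_left
        (le_shapeSymbol hq hy0 hy ht0 ht)

end Comparison

/-! ### Strictness, compactness and conclusion -/

section Main

variable {q : ℕ}

theorem sqrt_mul_add_sqrt_mul_le {a b a' b' : ℝ} (ha : 0 ≤ a) (hb : 0 ≤ b) (ha' : 0 ≤ a')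
    (hb' : 0 ≤ b') : √a * √b + √a' * √b' ≤ √(a + a') * √(b + b') := by
  rw [← Real.sqrt_mul (add_nonneg ha ha')]
  refine Real.le_sqrt_of_sq_le ?_
  have h1 := Real.sq_sqrt ha
  have h2 := Real.sq_sqrt hb
  have h3 := Real.sq_sqrt ha'
  have h4 := Real.sq_sqrt hb'
  have h := sq_nonneg (√a * √b' - √a' * √b)
  calc (√a * √b + √a' * √b') ^ 2
      ≤ (√a * √b + √a' * √b') ^ 2 + (√a * √b' - √a' * √b) ^ 2 := by linarith
    _ = (√a ^ 2 + √a' ^ 2) * (√b ^ 2 + √b' ^ 2) := by ring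
    _ = _ := by rw [h1, h2, h3, h4]

/-- After expansion of the squares only cross terms `√a√b` are nonlinear, and these are
superadditive by Cauchy–Schwarz. With homogeneity this makes the symbol concave. -/
theorem shapeSymbol_add_le (hq : 2 ≤ q) {a b c a' b' c' : ℝ} (ha : 0 ≤ a) (hb : 0 ≤ b)
    (hc : 0 ≤ c) (ha' : 0 ≤ a') (hb' : 0 ≤ b') (hc' : 0 ≤ c') :
    shapeSymbol q a b c + shapeSymbol q a' b' c' ≤ shapeSymbol q (a + a') (b + b') (c + c') := by
  have hq1 : (2 : ℝ) ≤ q := by exact_mod_cast hq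
  have hu : 0 ≤ (q : ℝ) - 1 := by linarith
  have hv : 0 ≤ (q : ℝ) * (q - 1) := by positivity
  unfold shapeSymbol
  rw [mul_add, mul_add]
  set B := ((q : ℝ) - 1) * b
  set B' := ((q : ℝ) - 1) * b'
  set D := (q : ℝ) * (q - 1) * c
  set D' := (q : ℝ) * (q - 1) * c'
  have hB : 0 ≤ B := mul_nonneg hu hb
  have hB' : 0 ≤ B' := mul_nonneg hu hb'
  have hD : 0 ≤ D := mul_nonneg hv hc
  have hD' : 0 ≤ D' := mul_nonneg hv hc'
  have m1 := sqrt_mul_add_sqrt_mul_le ha hB ha' hB'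
  have m2 := sqrt_mul_add_sqrt_mul_le ha hD ha' hD'
  have m3 := sqrt_mul_add_sqrt_mul_le hB hD hB' hD'
  have s1 := Real.sq_sqrt ha
  have s2 := Real.sq_sqrt hB
  have s3 := Real.sq_sqrt hD
  have s1' := Real.sq_sqrt ha'
  have s2' := Real.sq_sqrt hB'
  have s3' := Real.sq_sqrt hD'
  have t1 := Real.sq_sqrt (add_nonneg ha ha')
  have t2 := Real.sq_sqrt (add_nonneg hB hB')
  have t3 := Real.sq_sqrt (add_nonneg hD hD')
  have e1 : (√a + √B) ^ 2 / q + (√a' + √B') ^ 2 / q ≤ (√(a + a') + √(B + B')) ^ 2 / q := by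
    rw [← add_div]
    gcongr
    linarith
  have e2 : (√a + √B + √D) ^ 2 / q ^ 2 + (√a' + √B' + √D') ^ 2 / q ^ 2 ≤
      (√(a + a') + √(B + B') + √(D + D')) ^ 2 / q ^ 2 := by
    rw [← add_div]
    gcongr
    linarith
  linarith

theorem shapeSymbol_smul (q : ℕ) {s : ℝ} (hs : 0 ≤ s) (a b c : ℝ) :
    shapeSymbol q (s * a) (s * b) (s * c) = s * shapeSymbol q a b c := by
  unfold shapeSymbol
  rw [mul_left_comm, mul_left_comm _ s c, Real.sqrt_mul hs, Real.sqrt_mul hs, Real.sqrt_mul hs]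
  have h := Real.sq_sqrt hs
  have e1 : (√s * √a + √s * √((q - 1) * b)) ^ 2 = s * (√a + √((q - 1) * b)) ^ 2 := by
    rw [← mul_add, mul_pow, h]
  have e2 : (√s * √a + √s * √((q - 1) * b) + √s * √(q * (q - 1) * c)) ^ 2 =
      s * (√a + √((q - 1) * b) + √(q * (q - 1) * c)) ^ 2 := by
    rw [← mul_add, ← mul_add, mul_pow, h]
  rw [e1, e2]
  ring

theorem shapeSymbol_uniform (hq : 2 ≤ q) :
    shapeSymbol q (1 / (q : ℝ) ^ 2) (((q : ℝ) - 1) / (q : ℝ) ^ 2) (((q : ℝ) - 1) / q) = 2 := by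
  have hq1 : (2 : ℝ) ≤ q := by exact_mod_cast hq
  have hq0 : (q : ℝ) ≠ 0 := by linarith
  have hu : 0 ≤ (q : ℝ) - 1 := by linarith
  unfold shapeSymbol
  have e0 : √(1 / (q : ℝ) ^ 2) = 1 / q := by
    exact (Real.sqrt_eq_iff_mul_self_eq (by positivity) (by positivity)).2 (by ring)
  have e1 : √(((q : ℝ) - 1) * ((q - 1) / (q : ℝ) ^ 2)) = (q - 1) / q := by
    exact (Real.sqrt_eq_iff_mul_self_eq (by positivity) (by positivity)).2 (by ring)
  have e2 : √((q : ℝ) * (q - 1) * ((q - 1) / q)) = q - 1 := by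
    exact (Real.sqrt_eq_iff_mul_self_eq (by positivity) hu).2 (by field_simp)
  rw [e0, e1, e2]
  field_simp
  ring

theorem lt_one_of_mem_box (hq : 2 ≤ q) {y t : ℝ} (hy : y ≤ ((q : ℝ) - 1) / q ^ 2)
    (ht : t ≤ ((q : ℝ) - 1) / q) :
    y < 1 ∧ 1 / (q : ℝ) ≤ 1 - t ∧ 1 / (q : ℝ) ^ 2 ≤ 1 - y - t := by
  have hq1 : (2 : ℝ) ≤ q := by exact_mod_cast hq
  have hq0 : (q : ℝ) ≠ 0 := by linarith
  have e1 : ((q : ℝ) - 1) / q = 1 - 1 / q := by field_simp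
  have e2 : ((q : ℝ) - 1) / q ^ 2 = 1 / q - 1 / q ^ 2 := by field_simp
  have h1 : 1 / (q : ℝ) ≤ 1 := by rw [div_le_one (by linarith)]; linarith
  have h2 : 0 < 1 / (q : ℝ) ^ 2 := by positivity
  refine ⟨by linarith, by linarith, by linarith⟩

theorem rateExponent_nonneg (hq : 2 ≤ q) {y t : ℝ} (hy0 : 0 ≤ y)
    (hy : y ≤ ((q : ℝ) - 1) / q ^ 2) (ht0 : 0 ≤ t) (ht : t ≤ ((q : ℝ) - 1) / q) :
    0 ≤ rateExponent q (y, t) := by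
  have hq1 : (2 : ℝ) ≤ q := by exact_mod_cast hq
  obtain ⟨hy1, ht1, -⟩ := lt_one_of_mem_box hq hy ht
  have hs : 0 < 1 - t := lt_of_lt_of_le (by positivity) ht1
  have h := two_mul_rateExponent hq hy1 (by linarith : t < 1)
  have hfac : 0 ≤ (q : ℝ) / (q - 1) := div_nonneg (by linarith) (by linarith)
  have hx : y / (1 - t) ≤ ((q : ℝ) - 1) / q := by
    rw [div_le_iff₀ hs]
    calc y ≤ ((q : ℝ) - 1) / q * (1 / q) := by rw [div_mul_div_comm, mul_one, ← sq]; exact hy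
      _ ≤ _ := mul_le_mul_of_nonneg_left ht1 (div_nonneg (by linarith) (by linarith))
  have h1 := (mul_nonneg hfac ht0).trans (mul_div_le_entropyq hq ht0 ht)
  have h2 := (mul_nonneg hfac (div_nonneg hy0 hs.le)).trans
    (mul_div_le_entropyq hq (div_nonneg hy0 hs.le) hx)
  have h3 := mul_nonneg hs.le h2
  linarith

/-- Mixing in a little of the uniform distribution, whose symbol is `2 > c`, makes all masses
positive and, by concavity, lifts the symbol strictly above `c`. Continuity keeps the entropy
increase below the allowance from `η`. -/
theorem exists_hasCertificate_of_le_shapeSymbol [NeZero q] (hq : 2 ≤ q) {y t c η : ℝ}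
    (hy0 : 0 ≤ y) (hy : y ≤ ((q : ℝ) - 1) / q ^ 2) (ht0 : 0 ≤ t) (ht : t ≤ ((q : ℝ) - 1) / q)
    (hc : c ≤ shapeSymbol q (1 - y - t) y t) (hc2 : c < 2) (hη : 0 < η) :
    ∃ μ, c < μ ∧ HasCertificate q μ (rateExponent q (y, t) + η) := by
  have hq1 : (2 : ℝ) ≤ q := by exact_mod_cast hq
  have hq0 : (q : ℝ) ≠ 0 := by linarith
  have hlog : 0 < Real.log q := Real.log_pos (by linarith)
  obtain ⟨hy1, -, hp⟩ := lt_one_of_mem_box hq hy ht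
  set u₀ := 1 / (q : ℝ) ^ 2 with hu₀
  set u₁ := ((q : ℝ) - 1) / (q : ℝ) ^ 2 with hu₁
  set u₂ := ((q : ℝ) - 1) / q with hu₂
  have h₀ : 0 < u₀ := by positivity
  have h₁ : 0 < u₁ := div_pos (by linarith) (by positivity)
  have h₂ : 0 < u₂ := div_pos (by linarith) (by linarith)
  have hsum : u₀ + u₁ + u₂ = 1 := by rw [hu₀, hu₁, hu₂]; field_simp; ring
  have hcont : Continuous fun ε : ℝ => shapeEntropy q ((1 - ε) * (1 - y - t) + ε * u₀)
      ((1 - ε) * y + ε * u₁) ((1 - ε) * t + ε * u₂) := by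
    have := (continuous_shapeEntropy q).comp (f := fun ε : ℝ => ((1 - ε) * (1 - y - t) + ε * u₀,
      (1 - ε) * y + ε * u₁, (1 - ε) * t + ε * u₂)) (by fun_prop)
    exact this
  have hlim := (hcont.tendsto 0).eventually_lt_const
    (show _ < 2 * (rateExponent q (y, t) + η) * Real.log q by
      simp only [sub_zero, one_mul, zero_mul, add_zero]
      rw [shapeEntropy_eq_rate hq (τ := (y, t)) hy1]
      nlinarith [mul_pos hη hlog])
  obtain ⟨ε, hε, hε0, hε1⟩ := ((hlim.filter_mono nhdsWithin_le_nhds).and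
    (Ioo_mem_nhdsGT (show (0 : ℝ) < 1 by norm_num))).exists
  have hε' : 0 < 1 - ε := by linarith
  have hsym := shapeSymbol_add_le hq (mul_nonneg hε'.le (h₀.le.trans hp)) (mul_nonneg hε'.le hy0)
    (mul_nonneg hε'.le ht0) (mul_nonneg hε0.le h₀.le) (mul_nonneg hε0.le h₁.le)
    (mul_nonneg hε0.le h₂.le)
  rw [shapeSymbol_smul q hε'.le, shapeSymbol_smul q hε0.le, shapeSymbol_uniform hq] at hsym
  have hpos : 0 ≤ shapeSymbol q (1 - y - t) y t := by unfold shapeSymbol; positivity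
  have hlt : max 0 c < shapeSymbol q ((1 - ε) * (1 - y - t) + ε * u₀)
      ((1 - ε) * y + ε * u₁) ((1 - ε) * t + ε * u₂) := by
    refine lt_of_lt_of_le (max_lt ?_ ?_) hsym
    · nlinarith
    · nlinarith
  obtain ⟨μ, hμ, hμ'⟩ := exists_between hlt
  refine ⟨μ, (le_max_right _ _).trans_lt hμ, hasCertificate_shape hq ?_ ?_ ?_ ?_
    ((le_max_left _ _).trans hμ.le) hμ' hε⟩
  · exact add_pos_of_nonneg_of_pos (mul_nonneg hε'.le (h₀.le.trans hp)) (mul_pos hε0 h₀)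
  · exact add_pos_of_nonneg_of_pos (mul_nonneg hε'.le hy0) (mul_pos hε0 h₁)
  · exact add_pos_of_nonneg_of_pos (mul_nonneg hε'.le ht0) (mul_pos hε0 h₂)
  · linear_combination ε * hsum

theorem exists_hasCertificate_of_plotkin [NeZero q] (hq : 2 ≤ q) {c r η : ℝ} (hr : 0 ≤ r)
    (hc : c - (1 / (q : ℝ) + 1 / q ^ 2) ≤ r * (2 - (1 / (q : ℝ) + 1 / q ^ 2))) (hc2 : c < 2)
    (hη : 0 < η) : ∃ μ ρ, c < μ ∧ ρ ≤ r + η ∧ HasCertificate q μ ρ := by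
  have hq1 : (2 : ℝ) ≤ q := by exact_mod_cast hq
  have h1 : 1 / (q : ℝ) ≤ 1 / 2 := one_div_le_one_div_of_le (by norm_num) hq1
  have h2 : 1 / (q : ℝ) ^ 2 ≤ 1 / 2 := one_div_le_one_div_of_le (by norm_num) (by nlinarith)
  -- The fraction of blocks is capped at `1`, where the eigenvalue is `2 > c`; otherwise the extra
  -- `η / 2` gives strictness.
  refine ⟨_, min 1 (r + η / 2) + η / 2, ?_, ?_, hasCertificate_plotkin hq
    (le_min zero_le_one (by linarith)) (min_le_left _ _) (half_pos hη)⟩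
  · rcases min_choice 1 (r + η / 2) with h | h <;> rw [h]
    · linarith
    · nlinarith
  · linarith [min_le_right 1 (r + η / 2)]

theorem exists_hasCertificate_of_mem_feasiblePairs [NeZero q] (hq : 2 ≤ q) {δ η : ℝ} {τ : ℝ × ℝ}
    (hτ : τ ∈ feasiblePairs q δ) (hη : 0 < η) :
    ∃ μ ρ, 2 - 2 * δ < μ ∧ ρ ≤ rateExponent q τ + η ∧ HasCertificate q μ ρ := by
  obtain ⟨y, t⟩ := τ
  obtain ⟨hy0, hy, ht0, ht, hδ⟩ := hτ
  dsimp only at hy0 hy ht0 ht hδ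
  have hq1 : (2 : ℝ) ≤ q := by exact_mod_cast hq
  obtain ⟨hy1, ht1, -⟩ := lt_one_of_mem_box hq hy ht
  have hs : 0 < 1 - t := lt_of_lt_of_le (by positivity) ht1
  have hγ := krawtchoukGamma_pos hq hy0 hy
  have hγ2 : krawtchoukGamma q t ≤ 1 := by
    unfold krawtchoukGamma
    have : 0 ≤ (2 : ℝ) / q * √((q - 1) * t * (1 - t)) := by positivity
    have : 0 ≤ ((q : ℝ) - 2) / q * t := mul_nonneg (div_nonneg (by linarith) (by linarith)) ht0
    have : ((q : ℝ) - 1) / q ≤ 1 := by rw [div_le_one (by linarith)]; linarith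
    linarith
  have hγ0 : 0 ≤ krawtchoukGamma q t := krawtchoukGamma_nonneg hq ht0 (by linarith)
  set c := (2 - krawtchoukGamma q t) * (1 - (1 - t) * krawtchoukGamma q y) with hc
  have hcδ : 2 - 2 * δ ≤ c := by rw [hc]; linarith
  have hc2 : c < 2 := by
    have := mul_pos (mul_pos (by linarith : 0 < 2 - krawtchoukGamma q t) hs) hγ
    rw [hc]
    linarith
  rcases le_shapeSymbol_or_le_rate hq hy0 hy ht0 ht with h | h
  · obtain ⟨μ, h1, h2⟩ := exists_hasCertificate_of_le_shapeSymbol hq hy0 hy ht0 ht h hc2 hη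
    exact ⟨μ, _, hcδ.trans_lt h1, le_rfl, h2⟩
  · obtain ⟨μ, ρ, h1, h2⟩ := exists_hasCertificate_of_plotkin hq
      (rateExponent_nonneg hq hy0 hy ht0 ht) h hc2 hη
    exact ⟨μ, ρ, hcδ.trans_lt h1, h2⟩

theorem isCompact_feasiblePairs (q : ℕ) (δ : ℝ) : IsCompact (feasiblePairs q δ) := by
  have hγ := continuous_krawtchoukGamma q
  refine (isCompact_Icc (a := ((0 : ℝ), (0 : ℝ)))
    (b := (((q : ℝ) - 1) / (q : ℝ) ^ 2, ((q : ℝ) - 1) / q))).of_isClosed_subset ?_ ?_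
  · have h (f g : ℝ × ℝ → ℝ) (hf : Continuous f) (hg : Continuous g) :
        IsClosed {τ | f τ ≤ g τ} := isClosed_le hf hg
    exact (h _ _ (by fun_prop) (by fun_prop)).inter <| (h _ _ (by fun_prop) (by fun_prop)).inter <|
      (h _ _ (by fun_prop) (by fun_prop)).inter <| (h _ _ (by fun_prop) (by fun_prop)).inter <|
      h _ _ (by fun_prop) (by fun_prop)
  · rintro ⟨y, t⟩ ⟨h1, h2, h3, h4, -⟩
    exact ⟨⟨h1, h3⟩, ⟨h2, h4⟩⟩

theorem continuousOn_rateExponent (hq : 2 ≤ q) (δ : ℝ) :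
    ContinuousOn (rateExponent q) (feasiblePairs q δ) := by
  have hlog : 0 < Real.log q := Real.log_pos (by exact_mod_cast (by omega : 1 < q))
  -- The entropy form of the objective has no quotient `τ₂/(1 - τ₁)`, so its continuity is
  -- immediate.
  have hcont : Continuous fun τ : ℝ × ℝ =>
      shapeEntropy q (1 - τ.1 - τ.2) τ.1 τ.2 / (2 * Real.log q) :=
    ((continuous_shapeEntropy q).comp (f := fun τ : ℝ × ℝ => (1 - τ.1 - τ.2, τ.1, τ.2))
      (by fun_prop)).div_const _
  refine hcont.continuousOn.congr fun τ hτ => ?_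
  dsimp only
  rw [shapeEntropy_eq_rate hq (lt_one_of_mem_box hq hτ.2.1 hτ.2.2.2.1).1]
  field_simp

end Main

theorem theorem6p1 (q : ℕ) (hq : 2 ≤ q) (δ : ℝ) (hδ : (feasiblePairs q δ).Nonempty) :
    IsLeast (rateExponent q '' feasiblePairs q δ) (codeBoundPhi q δ) ∧
    (∀ (n M d : ℕ → ℕ) (C : ∀ i, Finset (NRTSpace q 2 (n i))) (R : ℝ),
      Tendsto n atTop atTop →
      (∀ i, IsOrderedCode (C i) (M i) (d i)) →
      HasAsymptoticRate q 2 n M R →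
      HasRelativeLimit 2 n d δ →
      R ≤ codeBoundPhi q δ) ∧
    (∀ (n M t θ : ℕ → ℕ) (A : ∀ i, Finset (NRTSpace q 2 (n i))) (R : ℝ),
      Tendsto n atTop atTop →
      (∀ i, IsOOA (A i) (M i) (t i) (θ i)) →
      HasAsymptoticRate q 2 n M R →
      HasRelativeLimit 2 n t δ →
      1 - codeBoundPhi q δ ≤ R) := by
  have : NeZero q := ⟨by omega⟩
  have hleast : IsLeast (rateExponent q '' feasiblePairs q δ) (codeBoundPhi q δ) :=
    ((isCompact_feasiblePairs q δ).image_of_continuousOn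
      (continuousOn_rateExponent hq δ)).isLeast_sInf (hδ.image _)
  obtain ⟨τ, hτ, hΦ⟩ := hleast.1
  refine ⟨hleast, fun n M d C R hn hC hR hd => ?_, fun n M t θ A R hn hA hR ht => ?_⟩
  · refine le_of_forall_pos_le_add fun η hη => ?_
    obtain ⟨μ, ρ, hμ, hρ, hc⟩ := exists_hasCertificate_of_mem_feasiblePairs hq hτ hη
    rw [← hΦ]
    exact (hc.rate_le hq hμ hn hC hR hd).trans hρ
  · refine le_of_forall_pos_le_add fun η hη => ?_
    obtain ⟨μ, ρ, hμ, hρ, hc⟩ := exists_hasCertificate_of_mem_feasiblePairs hq hτ hη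
    have := hc.le_rate hq hμ hn hA hR ht
    rw [← hΦ]
    linarith
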